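/- Let $\mathcal L=\{+,\cdot\,;0,1\}$, and for an $\mathcal L$-structure $\mathcal M$ let $\mathrm{Th}(\mathcal M)$ be the set of all first-order $\mathcal L$-sentences (with equality) that hold in $\mathcal M$. Write $\mathcal N=\langle\mathbb N;+,\cdot\,;0,1\rangle$ and $\mathcal Z=\langle\mathbb Z;+,\cdot\,;0,1\rangle$. Sentences are written as words over a fixed finite alphabet, the variable $v_n$ being written as the letter $v$ followed by $n$ primes. A set $T$ of $\mathcal L$-sentences is called decidable if there is a Turing machine (with one two-way infinite tape, finitely many states, and a finite alphabet that contains the alphabet of formulas) which, for every $\mathcal L$-sentence $\alpha$, when started on the input $\alpha$, stops after finitely many steps, with the output YES if $\alpha\in T$ and the output NO if $\alpha\notin T$; here YES and NO are two distinct fixed words over the alphabet of the machine, and the output is what is on the tape when the machine stops. Let $\mathrm{PA}$ be the first-order Peano axioms in the language $\mathcal L$: $x+1\neq 0$; $x+1=y+1\to x=y$; $x+0=x$; $x+(y+1)=(x+y)+1$; $x\cdot 0=0$; $x\cdot(y+1)=x\cdot y+x$ (universally closed); and induction for every $\mathcal L$-formula, with parameters. Then: 1. $\mathrm{Th}(\mathcal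 N)$ is undecidable. 2. The Peano axioms do not axiomatise all of $\mathrm{Th}(\mathcal N)$: every sentence that holds in all models of $\mathrm{PA}$ holds in $\mathcal N$, but there is a sentence $\alpha$ with $\mathcal N\models\alpha$ that fails in some model of $\mathrm{PA}$. 3. $\mathrm{Th}(\mathcal Z)$ is undecidable. -/

import Mathlib

open FirstOrder FirstOrder.Language

namespace Arith

/-! ### The language `{+, ·; 0, 1}` and its standard structures -/

/-- The function symbols of the language `{+, ·; 0, 1}`, with their arities. -/
inductive ArithFunc : ℕ → Type
  | zero : ArithFunc 0
  | one : ArithFunc 0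
  | add : ArithFunc 2
  | mul : ArithFunc 2

/-- The first-order language `{+, ·; 0, 1}`, without relation symbols other than equality. -/
def arith : Language :=
  { Functions := ArithFunc
    Relations := fun _ => Empty }

instance (α : Type) : Zero (arith.Term α) := ⟨Constants.term ArithFunc.zero⟩

instance (α : Type) : One (arith.Term α) := ⟨Constants.term ArithFunc.one⟩

instance (α : Type) : Add (arith.Term α) := ⟨Functions.apply₂ ArithFunc.add⟩

instance (α : Type) : Mul (arith.Term α) := ⟨Functions.apply₂ ArithFunc.mul⟩

/-- The structure `⟨R; +, ·; 0, 1⟩`; it is used for `R = ℕ` and `R = ℤ`. -/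
instance arithStructure (R : Type) [Zero R] [One R] [Add R] [Mul R] : arith.Structure R where
  funMap
    | ArithFunc.zero, _ => 0
    | ArithFunc.one, _ => 1
    | ArithFunc.add, x => x 0 + x 1
    | ArithFunc.mul, x => x 0 * x 1
  RelMap r _ := nomatch r

/-! ### Sentences as words over a finite alphabet

Every sentence is written out, fully parenthesised, as a word over a fixed finite alphabet. The
variable number `k` is the word `v′…′` with `k` primes. In `arith.BoundedFormula Empty n` the
variables in scope have the numbers `0, …, n - 1`, and a quantifier in front of a formula with
`n + 1` variables binds the variable with the number `n`. -/

/-- The alphabet for formulas. -/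
inductive Letter
  | plus | times | zero | one | eq | lpar | rpar | bot | imp | all | v | prime
  deriving DecidableEq

/-- The variable number `k`: the letter `v` followed by `k` primes. -/
def varWord (k : ℕ) : List Letter := Letter.v :: List.replicate k Letter.prime

/-- A term, written as a word: `(s+t)`, `(s·t)`, `0`, `1` or a variable. -/
def termWord {n : ℕ} : arith.Term (Empty ⊕ Fin n) → List Letter
  | Term.var (Sum.inr i) => varWord i
  | Term.func ArithFunc.zero _ => [Letter.zero]
  | Term.func ArithFunc.one _ => [Letter.one]
  | Term.func ArithFunc.add ts =>
      [Letter.lpar] ++ termWord (ts 0) ++ [Letter.plus] ++ termWord (ts 1) ++ [Letter.rpar]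
  | Term.func ArithFunc.mul ts =>
      [Letter.lpar] ++ termWord (ts 0) ++ [Letter.times] ++ termWord (ts 1) ++ [Letter.rpar]

/-- A formula, written as a word: `⊥`, `s=t`, `(φ→ψ)` or `∀v′…′φ`. -/
def formulaWord : {n : ℕ} → arith.BoundedFormula Empty n → List Letter
  | _, BoundedFormula.falsum => [Letter.bot]
  | _, BoundedFormula.equal s t => termWord s ++ [Letter.eq] ++ termWord t
  | _, BoundedFormula.imp φ ψ =>
      [Letter.lpar] ++ formulaWord φ ++ [Letter.imp] ++ formulaWord ψ ++ [Letter.rpar]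
  | n, BoundedFormula.all φ => [Letter.all] ++ varWord n ++ formulaWord φ

/-- The word over the alphabet `Letter` that represents a sentence. -/
def sentenceWord (α : arith.Sentence) : List Letter := formulaWord (n := 0) α

/-! ### Decision by Turing machines

A Turing machine over a finite alphabet `A` is a machine `Turing.TM0.Machine (Option A) Λ` with a
finite set `Λ` of states: one head on a two-way infinite tape, every cell of which is empty (`none`)
or holds one letter of `A`; in each step the state and the scanned cell determine whether the
machine stops, or which new state it enters and whether it writes on the scanned cell, moves one
cell to the left, or moves one cell to the right. -/

/-- The word `w`, and nothing else, is on the tape `T`, wherever the head is. -/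
def Shows {A : Type} (T : Turing.Tape (Option A)) (w : List A) : Prop :=
  ∃ (d : Turing.Dir) (n : ℕ), (Turing.Tape.move d)^[n] T = Turing.Tape.mk₁ (w.map some)

/-- Started in its initial state on the first letter of the word `w` on an otherwise empty tape,
the machine `M` stops after finitely many steps, and the word `u` is then what is on the tape. -/
def Outputs {A Λ : Type} [Inhabited Λ] (M : Turing.TM0.Machine (Option A) Λ) (w u : List A) :
    Prop :=
  ∃ c : Turing.TM0.Cfg (Option A) Λ,
    Turing.TM0.Reaches M (Turing.TM0.init (w.map some)) c ∧
      Turing.TM0.step M c = none ∧ Shows c.Tape u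

/-- The machine `M`, over an alphabet `A` that contains `Letter` through `e`, decides the theory
`T`: with the distinct words `yes` and `no` as answers, it stops on every input that is a
sentence, with the answer `yes` if the sentence belongs to `T` and with the answer `no`
otherwise. -/
def Decides {A Λ : Type} [Inhabited Λ] (M : Turing.TM0.Machine (Option A) Λ) (e : Letter ↪ A)
    (yes no : List A) (T : arith.Theory) : Prop :=
  yes ≠ no ∧ ∀ α : arith.Sentence,
    (α ∈ T → Outputs M ((sentenceWord α).map e) yes) ∧
      (α ∉ T → Outputs M ((sentenceWord α).map e) no)

/-- The theory `T` is decidable: some Turing machine with a finite alphabet and finitely many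
states decides, for every sentence, whether it belongs to `T`. -/
def DecidableTheory (T : arith.Theory) : Prop :=
  ∃ (A Λ : Type) (_ : Finite A) (_ : Finite Λ) (_ : Inhabited Λ)
    (M : Turing.TM0.Machine (Option A) Λ) (e : Letter ↪ A) (yes no : List A), Decides M e yes no T

/-! ### Peano arithmetic -/

/-- The formula `φ(x₀, …, xₙ₋₁, t)` for a term `t` in the variables `x₀, …, xₘ₋₁`, `n ≤ m`. -/
def substLast {n m : ℕ} (h : n ≤ m) (φ : arith.Formula (Fin (n + 1))) (t : arith.Term (Fin m)) :
    arith.BoundedFormula Empty m :=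
  BoundedFormula.relabel (n := m) (k := 0) Sum.inr
    (BoundedFormula.subst φ
      (Fin.snoc (α := fun _ => arith.Term (Fin m)) (fun i => Term.var (Fin.castLE h i)) t))

/-- The induction axiom for the formula `φ(x₀, …, xₙ₋₁, y)`: the universal closure over the
parameters `x₀, …, xₙ₋₁` of `φ(0) → (∀ y, φ(y) → φ(y + 1)) → ∀ y, φ(y)`. -/
def inductionAxiom {n : ℕ} (φ : arith.Formula (Fin (n + 1))) : arith.Sentence :=
  BoundedFormula.alls
    ((substLast le_rfl φ 0).imp
      (((substLast n.le_succ φ (Term.var (Fin.last n))).imp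
          (substLast n.le_succ φ (Term.var (Fin.last n) + 1))).all.imp
        (substLast n.le_succ φ (Term.var (Fin.last n))).all))

/-- The variable `xᵢ` as a term in a formula with the variables `x₀, …, xₙ₋₁`. -/
def bvar {n : ℕ} (i : Fin n) : arith.Term (Empty ⊕ Fin n) := Term.var (Sum.inr i)

/-- The (first-order) Peano axioms in the language `{+, ·; 0, 1}`; the successor of `x` is
`x + 1`. -/
inductive IsPeanoAxiom : arith.Sentence → Prop
  /-- `∀ x, ¬ x + 1 = 0` -/
  | succ_ne_zero : IsPeanoAxiom (BoundedFormula.alls (n := 1)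
      (((bvar 0 + 1).bdEqual 0).imp ⊥))
  /-- `∀ x y, x + 1 = y + 1 → x = y` -/
  | succ_inj : IsPeanoAxiom (BoundedFormula.alls (n := 2)
      (((bvar 0 + 1).bdEqual (bvar 1 + 1)).imp ((bvar 0).bdEqual (bvar 1))))
  /-- `∀ x, x + 0 = x` -/
  | add_zero : IsPeanoAxiom (BoundedFormula.alls (n := 1)
      ((bvar 0 + 0).bdEqual (bvar 0)))
  /-- `∀ x y, x + (y + 1) = (x + y) + 1` -/
  | add_succ : IsPeanoAxiom (BoundedFormula.alls (n := 2)
      ((bvar 0 + (bvar 1 + 1)).bdEqual (bvar 0 + bvar 1 + 1)))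
  /-- `∀ x, x · 0 = 0` -/
  | mul_zero : IsPeanoAxiom (BoundedFormula.alls (n := 1)
      ((bvar 0 * 0).bdEqual 0))
  /-- `∀ x y, x · (y + 1) = x · y + x` -/
  | mul_succ : IsPeanoAxiom (BoundedFormula.alls (n := 2)
      ((bvar 0 * (bvar 1 + 1)).bdEqual (bvar 0 * bvar 1 + bvar 0)))
  /-- the induction axiom for each formula `φ(x₀, …, xₙ₋₁, y)` -/
  | induction (n : ℕ) (φ : arith.Formula (Fin (n + 1))) : IsPeanoAxiom (inductionAxiom φ)

/-- Peano arithmetic. -/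
def peano : arith.Theory := {α | IsPeanoAxiom α}

end Arith

/-! All three statements are instances of Tarski's diagonal argument. Every primitive recursive
relation is definable in `ℕ`: recursion is expressed by quantifying over a number that codes the
whole sequence of values through Gödel's β-function (`arithmetical_of_natPrimrec`).

Undecidability. One step of a Turing machine is primitive recursive, so "the machine `M` answers
`u`" is arithmetical, being "for some `k`, ..." (`arithmetical_answers`). If `M` decided the theory,
some formula `φ(n)` would say that `M` answers NO on the sentence `ψ(n)`, where `ψ` is the formula
whose word has the code `n`. With `n` the code of `φ` itself, `φ(n)` would hold if and only if `M`
rejects it (`not_decidableTheory`). For `ℤ`, formulas are relativised to the nonnegative integers,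
which are definable by Lagrange's four-square theorem (`exists_formula_int`).

Incompleteness. The same diagonal argument applies once "`α` is not a consequence of PA" is
arithmetical in the code of `α`. No proof calculus is used. A countermodel is described by a set `X`
of codes of true statements about named elements, with names for Skolem witnesses, so that the
requirements on `X` are quantifier-free conditions `HenkinCond` with four numerical parameters
(`not_models_iff`). Each condition inspects only finitely many members of `X`. By compactness, with
an ultrafilter limit, such an `X` exists if and only if for each `N` some finite set satisfies the
first `N` conditions (`exists_henkinCond_iff`). This replaces the quantifier over sets by
quantifiers over numbers. The resulting `φ`, applied to its own code, is a sentence that is true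
exactly if it does not follow from PA. -/

namespace Arith

/-! ### Arithmetical relations -/

/-- The term function `f` is given by a term of the language of arithmetic. -/
def IsTermFun {k : ℕ} (f : (Fin k → ℕ) → ℕ) : Prop :=
  ∃ t : arith.Term (Fin k), ∀ v, t.realize v = f v

/-- The relation `P` on the natural numbers is definable in arithmetic. -/
def Arithmetical {k : ℕ} (P : (Fin k → ℕ) → Prop) : Prop :=
  ∃ φ : arith.Formula (Fin k), ∀ v, φ.Realize v ↔ P v

section Realize

variable {R : Type} [Zero R] [One R] [Add R] [Mul R] {α : Type} (v : α → R)

@[simp] lemma realize_zero_term : (0 : arith.Term α).realize v = 0 := rfl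

@[simp] lemma realize_one_term : (1 : arith.Term α).realize v = 1 := rfl

@[simp] lemma realize_add_term (s t : arith.Term α) :
    (s + t).realize v = s.realize v + t.realize v := rfl

@[simp] lemma realize_mul_term (s t : arith.Term α) :
    (s * t).realize v = s.realize v * t.realize v := rfl

end Realize

namespace IsTermFun

variable {k : ℕ} {f g : (Fin k → ℕ) → ℕ}

lemma var (i : Fin k) : IsTermFun fun v => v i := ⟨Term.var i, fun _ => rfl⟩

lemma const (n : ℕ) : IsTermFun fun _ : Fin k → ℕ => n := by
  induction n with
  | zero => exact ⟨0, fun _ => rfl⟩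
  | succ n ih =>
    obtain ⟨t, ht⟩ := ih
    exact ⟨t + 1, fun v => by simp [ht]⟩

lemma add (hf : IsTermFun f) (hg : IsTermFun g) : IsTermFun fun v => f v + g v := by
  obtain ⟨s, hs⟩ := hf
  obtain ⟨t, ht⟩ := hg
  exact ⟨s + t, fun v => by simp [hs, ht]⟩

lemma mul (hf : IsTermFun f) (hg : IsTermFun g) : IsTermFun fun v => f v * g v := by
  obtain ⟨s, hs⟩ := hf
  obtain ⟨t, ht⟩ := hg
  exact ⟨s * t, fun v => by simp [hs, ht]⟩

end IsTermFun

namespace Arithmetical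

variable {k : ℕ} {P Q : (Fin k → ℕ) → Prop} {f g : (Fin k → ℕ) → ℕ}

lemma of_iff (hP : Arithmetical P) (h : ∀ v, Q v ↔ P v) : Arithmetical Q := by
  obtain ⟨φ, hφ⟩ := hP
  exact ⟨φ, fun v => (hφ v).trans (h v).symm⟩

lemma eq (hf : IsTermFun f) (hg : IsTermFun g) : Arithmetical fun v => f v = g v := by
  obtain ⟨s, hs⟩ := hf
  obtain ⟨t, ht⟩ := hg
  exact ⟨s.equal t, fun v => by simp [Formula.realize_equal, hs, ht]⟩

lemma not (hP : Arithmetical P) : Arithmetical fun v => ¬ P v := by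
  obtain ⟨φ, hφ⟩ := hP
  exact ⟨φ.not, fun v => by simp [Formula.realize_not, hφ]⟩

lemma imp (hP : Arithmetical P) (hQ : Arithmetical Q) : Arithmetical fun v => P v → Q v := by
  obtain ⟨φ, hφ⟩ := hP
  obtain ⟨ψ, hψ⟩ := hQ
  exact ⟨φ.imp ψ, fun v => by simp [Formula.realize_imp, hφ, hψ]⟩

lemma and (hP : Arithmetical P) (hQ : Arithmetical Q) : Arithmetical fun v => P v ∧ Q v :=
  (hP.imp hQ.not).not.of_iff fun v => by tauto

lemma or (hP : Arithmetical P) (hQ : Arithmetical Q) : Arithmetical fun v => P v ∨ Q v :=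
  (hP.not.imp hQ).of_iff fun v => by tauto

lemma ex {P : (Fin k → ℕ) → ℕ → Prop}
    (hP : Arithmetical fun v : Fin (k + 1) → ℕ => P (fun i => v i.castSucc) (v (Fin.last k))) :
    Arithmetical fun v => ∃ x, P v x := by
  obtain ⟨φ, hφ⟩ := hP
  refine ⟨(φ.relabel (Fin.snoc (α := fun _ => Fin k ⊕ Unit) Sum.inl (Sum.inr ()))).iExs Unit,
    fun v => ?_⟩
  simp only [Formula.realize_iExs, Formula.realize_relabel, hφ]
  constructor
  · rintro ⟨i, hi⟩
    exact ⟨i (), by simpa using hi⟩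
  · rintro ⟨x, hx⟩
    exact ⟨fun _ => x, by simpa using hx⟩

lemma all {P : (Fin k → ℕ) → ℕ → Prop}
    (hP : Arithmetical fun v : Fin (k + 1) → ℕ => P (fun i => v i.castSucc) (v (Fin.last k))) :
    Arithmetical fun v => ∀ x, P v x :=
  (ex (P := fun v x => ¬ P v x) hP.not).not.of_iff fun v => by simp

lemma subst {m : ℕ} {P : (Fin m → ℕ) → Prop} (hP : Arithmetical P)
    {f : Fin m → (Fin k → ℕ) → ℕ} (hf : ∀ i, IsTermFun (f i)) :
    Arithmetical fun v => P fun i => f i v := by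
  obtain ⟨φ, hφ⟩ := hP
  choose t ht using hf
  refine ⟨BoundedFormula.subst φ t, fun v => BoundedFormula.realize_subst.trans ?_⟩
  simpa only [ht, Formula.Realize] using hφ fun i => f i v

lemma rel₂ {P : ℕ → ℕ → Prop} (hP : Arithmetical fun v : Fin 2 → ℕ => P (v 0) (v 1))
    (hf : IsTermFun f) (hg : IsTermFun g) : Arithmetical fun v => P (f v) (g v) :=
  (hP.subst (f := ![f, g]) (by simp [Fin.forall_fin_two, hf, hg])).of_iff fun v => by simp

lemma rel₃ {P : ℕ → ℕ → ℕ → Prop}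
    (hP : Arithmetical fun v : Fin 3 → ℕ => P (v 0) (v 1) (v 2)) {h : (Fin k → ℕ) → ℕ}
    (hf : IsTermFun f) (hg : IsTermFun g) (hh : IsTermFun h) :
    Arithmetical fun v => P (f v) (g v) (h v) :=
  (hP.subst (f := ![f, g, h]) (by simp [Fin.forall_fin_succ, hf, hg, hh])).of_iff fun v => by
    simp

lemma lt (hf : IsTermFun f) (hg : IsTermFun g) : Arithmetical fun v => f v < g v := by
  have h : Arithmetical fun v : Fin 2 → ℕ => v 0 < v 1 :=
    (ex (P := fun v x => v 0 + x + 1 = v 1)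
      (eq (((IsTermFun.var _).add (.var _)).add (.const 1)) (.var _))).of_iff fun v => by
        constructor
        · intro h
          exact ⟨v 1 - v 0 - 1, by omega⟩
        · rintro ⟨x, hx⟩
          omega
  exact rel₂ (P := (· < ·)) h hf hg

lemma pair {h : (Fin k → ℕ) → ℕ} (hf : IsTermFun f) (hg : IsTermFun g) (hh : IsTermFun h) :
    Arithmetical fun v => Nat.pair (f v) (g v) = h v := by
  refine (((lt hf hg).and (eq ((hg.mul hg).add hf) hh)).or
    ((lt hf hg).not.and (eq (((hf.mul hf).add hf).add hg) hh))).of_iff fun v => ?_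
  unfold Nat.pair
  split_ifs with hlt <;> simp [hlt]

/-- `Nat.beta` is a remainder of one component of a pair modulo `(i + 1) * b + 1`, where `b` is the
other component, so its graph needs only division with remainder, with the quotient quantified. -/
lemma beta {h : (Fin k → ℕ) → ℕ} (hf : IsTermFun f) (hg : IsTermFun g) (hh : IsTermFun h) :
    Arithmetical fun v => Nat.beta (f v) (g v) = h v := by
  have key : Arithmetical fun v : Fin 3 → ℕ => Nat.beta (v 0) (v 1) = v 2 := by
    refine of_iff (P := fun v : Fin 3 → ℕ => ∃ a, ∃ b, ∃ q, Nat.pair a b = v 0 ∧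
      (v 2 < (v 1 + 1) * b + 1 ∧ ((v 1 + 1) * b + 1) * q + v 2 = a)) ?_ fun v => ?_
    · refine ex <| ex <| ex <| (pair (.var _) (.var _) (.var _)).and <| (lt (.var _) ?_).and
        (eq ?_ (.var _))
      · exact (((IsTermFun.var _).add (.const 1)).mul (.var _)).add (.const 1)
      · exact (((((IsTermFun.var _).add (.const 1)).mul (.var _)).add (.const 1)).mul
          (.var _)).add (.var _)
    · unfold Nat.beta
      constructor
      · intro h
        refine ⟨(v 0).unpair.1, (v 0).unpair.2, (v 0).unpair.1 / ((v 1 + 1) * (v 0).unpair.2 + 1),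
          by simp, ?_, ?_⟩
        · rw [← h]
          exact Nat.mod_lt _ (Nat.succ_pos _)
        · rw [← h]
          exact Nat.div_add_mod _ _
      · rintro ⟨a, b, q, h, hlt, rfl⟩
        rw [← h]
        simp [Nat.mod_eq_of_lt hlt]
  exact rel₃ (P := fun x y z => Nat.beta x y = z) key hf hg hh

end Arithmetical

/-- The Chinese remainder theorem, in the form of `Nat.unbeta`: one number codes any finite sequence
of values. -/
lemma exists_beta (f : ℕ → ℕ) (n : ℕ) : ∃ b, ∀ i ≤ n, Nat.beta b i = f i := by
  refine ⟨Nat.unbeta ((List.range (n + 1)).map f), fun i hi => ?_⟩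
  simpa using Nat.beta_unbeta_coe ((List.range (n + 1)).map f) ⟨i, by simp; omega⟩

open Arithmetical in
/-- The graph of a primitive recursive function is arithmetical. -/
theorem arithmetical_of_natPrimrec {f : ℕ → ℕ} (hf : Nat.Primrec f) :
    Arithmetical fun v : Fin 2 → ℕ => f (v 0) = v 1 := by
  induction hf with
  | zero => exact eq (.const 0) (.var _)
  | succ => exact eq ((IsTermFun.var 0).add (.const 1)) (.var 1)
  | left =>
    refine of_iff (P := fun v : Fin 2 → ℕ => ∃ z, Nat.pair (v 1) z = v 0)
      (ex (pair (.var _) (.var _) (.var _))) fun v => ⟨fun h => ⟨(v 0).unpair.2, ?_⟩, ?_⟩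
    · simp [← h]
    · rintro ⟨z, hz⟩
      simp [← hz]
  | right =>
    refine of_iff (P := fun v : Fin 2 → ℕ => ∃ z, Nat.pair z (v 1) = v 0)
      (ex (pair (.var _) (.var _) (.var _))) fun v => ⟨fun h => ⟨(v 0).unpair.1, ?_⟩, ?_⟩
    · simp [← h]
    · rintro ⟨z, hz⟩
      simp [← hz]
  | @pair f g _ _ ihf ihg =>
    refine of_iff (P := fun v : Fin 2 → ℕ => ∃ a, ∃ b, f (v 0) = a ∧ g (v 0) = b ∧
      Nat.pair a b = v 1) ?_ fun v => by simp
    exact ex <| ex <| (rel₂ (P := fun x y => f x = y) ihf (.var _) (.var _)).and <|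
      (rel₂ (P := fun x y => g x = y) ihg (.var _) (.var _)).and
        (Arithmetical.pair (.var _) (.var _) (.var _))
  | @comp f g _ _ ihf ihg =>
    refine of_iff (P := fun v : Fin 2 → ℕ => ∃ a, g (v 0) = a ∧ f a = v 1) ?_ fun v => by simp
    exact ex <| (rel₂ (P := fun x y => g x = y) ihg (.var _) (.var _)).and
      (rel₂ (P := fun x y => f x = y) ihf (.var _) (.var _))
  | @prec f g _ _ ihf ihg =>
    -- The number `b` codes the history of the recursion with parameter `z` up to `n`. The variables
    -- `u`, `p`, `q`, `w` name intermediate values, because pairing, β and `g` are available only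
    -- through their graphs.
    refine of_iff (P := fun v : Fin 2 → ℕ => ∃ z, ∃ n, ∃ b, Nat.pair z n = v 0 ∧
      (∃ a, f z = a ∧ Nat.beta b 0 = a) ∧ Nat.beta b n = v 1 ∧
      ∀ i, i < n → ∃ u, ∃ p, ∃ q, ∃ w, Nat.beta b i = u ∧ Nat.pair i u = p ∧ Nat.pair z p = q ∧
        g q = w ∧ Nat.beta b (i + 1) = w) ?_ fun v => ?_
    · refine ex <| ex <| ex <| (Arithmetical.pair (.var _) (.var _) (.var _)).and <|
        (ex <| (rel₂ (P := fun x y => f x = y) ihf (.var _) (.var _)).and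
          (beta (.var _) (.const 0) (.var _))).and <|
        (beta (.var _) (.var _) (.var _)).and <| all <| (lt (.var _) (.var _)).imp <|
        ex <| ex <| ex <| ex <| (beta (.var _) (.var _) (.var _)).and <|
        (Arithmetical.pair (.var _) (.var _) (.var _)).and <|
        (Arithmetical.pair (.var _) (.var _) (.var _)).and <|
        (rel₂ (P := fun x y => g x = y) ihg (.var _) (.var _)).and
          (beta (.var _) ((IsTermFun.var _).add (.const 1)) (.var _))
    · simp only [Nat.unpaired]
      constructor
      · intro h
        obtain ⟨b, hb⟩ := exists_beta (fun n => Nat.rec (f (v 0).unpair.1)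
          (fun y IH => g (Nat.pair (v 0).unpair.1 (Nat.pair y IH))) n) (v 0).unpair.2
        refine ⟨(v 0).unpair.1, (v 0).unpair.2, b, by simp, ⟨_, rfl, hb 0 (Nat.zero_le _)⟩,
          (hb _ le_rfl).trans h, fun i hi => ⟨_, _, _, _, rfl, rfl, rfl, rfl, ?_⟩⟩
        rw [hb (i + 1) hi, hb i hi.le]
      · rintro ⟨z, n, b, h, ⟨_, rfl, h0⟩, hn, hs⟩
        rw [← h]
        simp only [Nat.unpair_pair]
        rw [← hn]
        have : ∀ i ≤ n, Nat.rec (f z) (fun y IH => g (Nat.pair z (Nat.pair y IH))) i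
            = Nat.beta b i := by
          intro i
          induction i with
          | zero => intro _; exact h0.symm
          | succ i ih =>
            intro hi
            obtain ⟨_, _, _, _, rfl, rfl, rfl, rfl, hw⟩ := hs i hi
            rw [hw, ← ih (by omega)]
        exact this n le_rfl

/-- A primitive recursive predicate is arithmetical. -/
theorem arithmetical_of_primrecPred {p : ℕ → Prop} (hp : PrimrecPred p) :
    Arithmetical fun v : Fin 1 → ℕ => p (v 0) := by
  classical
  have h := Primrec.nat_iff.1 (Primrec.ite hp (Primrec.const 1) (Primrec.const 0))
  -- The predicate holds where its indicator function takes the value 1.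
  refine ((arithmetical_of_natPrimrec h).subst (k := 1) (f := ![fun v => v 0, fun _ => 1])
    (by simp [Fin.forall_fin_two, IsTermFun.var, IsTermFun.const])).of_iff fun v => by simp

lemma Arithmetical.of_primrecPred₂ {k : ℕ} {f g : (Fin k → ℕ) → ℕ} {p : ℕ → ℕ → Prop}
    (hp : PrimrecPred fun x : ℕ × ℕ => p x.1 x.2) (hf : IsTermFun f) (hg : IsTermFun g) :
    Arithmetical fun v => p (f v) (g v) := by
  have h := arithmetical_of_primrecPred (hp.comp Primrec.unpair)
  refine rel₂ (P := p) (of_iff (P := fun v : Fin 2 → ℕ => ∃ z, Nat.pair (v 0) (v 1) = z ∧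
    p z.unpair.1 z.unpair.2) ?_ fun v => by simp) hf hg
  exact ex <| (pair (.var _) (.var _) (.var _)).and <|
    h.subst (f := fun _ v => v 2) fun _ => .var _

lemma Arithmetical.of_primrecPred₃ {k : ℕ} {f g h : (Fin k → ℕ) → ℕ} {p : ℕ → ℕ → ℕ → Prop}
    (hp : PrimrecPred fun x : ℕ × ℕ × ℕ => p x.1 x.2.1 x.2.2) (hf : IsTermFun f)
    (hg : IsTermFun g) (hh : IsTermFun h) : Arithmetical fun v => p (f v) (g v) (h v) := by
  have hq : PrimrecPred fun x : ℕ × ℕ => p x.1 x.2.unpair.1 x.2.unpair.2 :=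
    hp.comp (Primrec.fst.pair (Primrec.unpair.comp Primrec.snd))
  refine rel₃ (P := p) (of_iff (P := fun v : Fin 3 → ℕ => ∃ z, Nat.pair (v 1) (v 2) = z ∧
    p (v 0) z.unpair.1 z.unpair.2) ?_ fun v => by simp) hf hg hh
  exact ex <| (pair (.var _) (.var _) (.var _)).and <|
    of_primrecPred₂ (p := fun x z => p x z.unpair.1 z.unpair.2) hq (.var _) (.var _)

/-! ### Arithmetical relations in the ring of integers -/

/-- The formula `∃ a b c d, x = a · a + b · b + (c · c + d · d)` for the last variable `x`. -/
def nonnegFormula (n : ℕ) : arith.BoundedFormula Empty (n + 1) :=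
  ((bvar (n := n + 1 + 1 + 1 + 1 + 1) (Fin.last n).castSucc.castSucc.castSucc.castSucc).bdEqual
    (bvar (Fin.last (n + 1)).castSucc.castSucc.castSucc *
        bvar (Fin.last (n + 1)).castSucc.castSucc.castSucc +
      bvar (Fin.last (n + 1 + 1)).castSucc.castSucc *
        bvar (Fin.last (n + 1 + 1)).castSucc.castSucc +
      (bvar (Fin.last (n + 1 + 1 + 1)).castSucc * bvar (Fin.last (n + 1 + 1 + 1)).castSucc +
        bvar (Fin.last (n + 1 + 1 + 1 + 1)) * bvar (Fin.last (n + 1 + 1 + 1 + 1))))).ex.ex.ex.ex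

/-- Lagrange's four-square theorem; the converse is that squares are nonnegative. -/
lemma realize_nonnegFormula {n : ℕ} (v : Empty → ℤ) (w : Fin n → ℤ) (x : ℤ) :
    (nonnegFormula n).Realize v (Fin.snoc w x) ↔ 0 ≤ x := by
  simp only [nonnegFormula, BoundedFormula.realize_ex, BoundedFormula.realize_bdEqual,
    realize_add_term, realize_mul_term, bvar, Term.realize_var, Sum.elim_inr, Fin.snoc_castSucc,
    Fin.snoc_last]
  constructor
  · rintro ⟨a, b, c, d, rfl⟩
    nlinarith [mul_self_nonneg a, mul_self_nonneg b, mul_self_nonneg c, mul_self_nonneg d]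
  · intro hx
    obtain ⟨a, b, c, d, h⟩ := Nat.sum_four_squares x.toNat
    refine ⟨a, b, c, d, ?_⟩
    have : (x.toNat : ℤ) = x := Int.toNat_of_nonneg hx
    rw [← this, ← h]
    push_cast
    ring

lemma realize_intCast {α : Type} (t : arith.Term α) (v : α → ℕ) :
    t.realize (fun i => (v i : ℤ)) = ((t.realize v : ℕ) : ℤ) := by
  induction t with
  | var i => rfl
  | func f ts ih =>
    cases f with
    | zero => rfl
    | one => rfl
    | add => exact (congrArg₂ (· + ·) (ih 0) (ih 1)).trans (Nat.cast_add _ _).symm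
    | mul => exact (congrArg₂ (· * ·) (ih 0) (ih 1)).trans (Nat.cast_mul _ _).symm

/-- Every formula about natural numbers can be translated into one about integers. -/
theorem exists_formula_int {n : ℕ} (φ : arith.BoundedFormula Empty n) :
    ∃ ψ : arith.BoundedFormula Empty n, ∀ v : Fin n → ℕ,
      ψ.Realize default (fun i => (v i : ℤ)) ↔ φ.Realize default v := by
  induction φ with
  | falsum => exact ⟨⊥, fun v => Iff.rfl⟩
  | equal s t =>
    refine ⟨s.bdEqual t, fun v => ?_⟩
    have : (Sum.elim default fun i => (v i : ℤ) : Empty ⊕ Fin _ → ℤ) =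
        fun i => ((Sum.elim default v : Empty ⊕ Fin _ → ℕ) i : ℤ) := by
      funext i
      rcases i with i | i
      · exact i.elim
      · rfl
    rw [BoundedFormula.realize_bdEqual, this, realize_intCast, realize_intCast, Nat.cast_inj]
    rfl
  | rel r => exact r.elim
  | imp φ ψ ihφ ihψ =>
    obtain ⟨φ', hφ⟩ := ihφ
    obtain ⟨ψ', hψ⟩ := ihψ
    exact ⟨φ'.imp ψ', fun v => by simp only [BoundedFormula.realize_imp, hφ, hψ]⟩
  | all φ ih =>
    obtain ⟨φ', hφ⟩ := ih
    -- The quantifier is restricted to the nonnegative integers, that is, to the casts of natural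
    -- numbers.
    refine ⟨((nonnegFormula _).imp φ').all, fun v => ?_⟩
    simp only [BoundedFormula.realize_all, BoundedFormula.realize_imp, realize_nonnegFormula, ← hφ]
    have key : ∀ x : ℕ, (fun i => ((Fin.snoc v x : Fin _ → ℕ) i : ℤ)) =
        (Fin.snoc (fun i => (v i : ℤ)) (x : ℤ) : Fin _ → ℤ) := by
      intro x
      funext i
      refine Fin.lastCases ?_ (fun i => ?_) i <;> simp
    constructor
    · intro h x
      rw [key]
      exact h x (Int.natCast_nonneg x)
    · intro h x hx
      lift x to ℕ using hx
      rw [← key]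
      exact h x

lemma Arithmetical.exists_boundedFormula {k : ℕ} {P : (Fin k → ℕ) → Prop} (hP : Arithmetical P) :
    ∃ φ : arith.BoundedFormula Empty k, ∀ v : Fin k → ℕ, φ.Realize default v ↔ P v := by
  obtain ⟨φ, hφ⟩ := hP
  exact ⟨BoundedFormula.relabel (n := k) (k := 0) Sum.inr φ,
    fun v => (Formula.realize_relabel_sumInr φ).trans (hφ v)⟩

/-- The numeral `n`. -/
def numeral {α : Type} : ℕ → arith.Term α
  | 0 => 0
  | n + 1 => numeral n + 1

lemma realize_numeral {R : Type} [CommSemiring R] {α : Type} (v : α → R) (n : ℕ) :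
    (numeral n : arith.Term α).realize v = n := by
  induction n with
  | zero => simp [numeral]
  | succ n ih => simp [numeral, ih]

/-- The sentence `∀ x, x = n → φ(x)`. -/
def atNumeral (φ : arith.BoundedFormula Empty 1) (n : ℕ) : arith.Sentence :=
  (((bvar 0).bdEqual (numeral n)).imp φ).all

lemma realize_atNumeral {R : Type} [CommSemiring R] (φ : arith.BoundedFormula Empty 1) (n : ℕ) :
    R ⊨ atNumeral φ n ↔ φ.Realize default fun _ => (n : R) := by
  have key : ∀ x : R, (Fin.snoc default x : Fin 1 → R) = fun _ => x := by
    intro x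
    funext i
    rw [show i = Fin.last 0 from Subsingleton.elim (α := Fin 1) _ _, Fin.snoc_last]
  rw [Sentence.Realize, Formula.Realize, atNumeral, BoundedFormula.realize_all]
  simp [BoundedFormula.realize_bdEqual, bvar, key, realize_numeral]

/-! ### Sentences as words -/

instance : Finite Letter :=
  Finite.of_surjective (fun i : Fin 12 => ![Letter.plus, .times, .zero, .one, .eq, .lpar, .rpar,
    .bot, .imp, .all, .v, .prime] i) fun l => by
      cases l
      exacts [⟨0, rfl⟩, ⟨1, rfl⟩, ⟨2, rfl⟩, ⟨3, rfl⟩, ⟨4, rfl⟩, ⟨5, rfl⟩, ⟨6, rfl⟩, ⟨7, rfl⟩,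
        ⟨8, rfl⟩, ⟨9, rfl⟩, ⟨10, rfl⟩, ⟨11, rfl⟩]

/-- A finite type is primitive recursively encodable. -/
noncomputable abbrev primcodableOfFinite (α : Type) [Finite α] : Primcodable α :=
  Primcodable.ofEquiv (Fin (Nat.card α)) (Finite.equivFin α)

noncomputable instance : Primcodable Letter := primcodableOfFinite Letter

/-- The word for the numeral `n`. -/
def numeralWord (n : ℕ) : List Letter :=
  Nat.rec [Letter.zero] (fun _ w => [Letter.lpar] ++ w ++ [Letter.plus, Letter.one, Letter.rpar]) n

lemma termWord_numeral {k : ℕ} (n : ℕ) :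
    termWord (numeral n : arith.Term (Empty ⊕ Fin k)) = numeralWord n := by
  induction n with
  | zero => rfl
  | succ n ih =>
    have : termWord (numeral (n + 1) : arith.Term (Empty ⊕ Fin k)) = [Letter.lpar] ++
      termWord (numeral n : arith.Term (Empty ⊕ Fin k)) ++ [Letter.plus] ++ [Letter.one] ++
        [Letter.rpar] := rfl
    rw [this, ih]
    simp [numeralWord]

/-- The word for the sentence `∀ x, x = n → φ(x)`, where `w` is the word for `φ`. -/
def atNumeralWord (w : List Letter) (n : ℕ) : List Letter :=
  [Letter.all, .v, .lpar, .v, .eq] ++ (numeralWord n ++ ([Letter.imp] ++ (w ++ [Letter.rpar])))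

/-- Writing `φ(n)` as `∀ x, x = n → φ(x)` avoids substitution: the word arises by concatenation
around the word of `φ`, hence is primitive recursive in that word and `n`. -/
lemma sentenceWord_atNumeral (φ : arith.BoundedFormula Empty 1) (n : ℕ) :
    sentenceWord (atNumeral φ n) = atNumeralWord (formulaWord φ) n := by
  have : sentenceWord (atNumeral φ n) = [Letter.all] ++ varWord 0 ++ ([Letter.lpar] ++
    (varWord 0 ++ [Letter.eq] ++ termWord (numeral n : arith.Term (Empty ⊕ Fin 1))) ++
      [Letter.imp] ++ formulaWord φ ++ [Letter.rpar]) := rfl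
  rw [this, termWord_numeral]
  simp [atNumeralWord, varWord]

lemma primrec_numeralWord : Primrec numeralWord :=
  Primrec.nat_rec₁ _ (Primrec.list_append.comp (Primrec.list_append.comp (Primrec.const _)
    Primrec.snd) (Primrec.const _)).to₂

lemma primrec_atNumeralWord : Primrec₂ atNumeralWord :=
  (Primrec.list_append.comp (Primrec.const _) <| Primrec.list_append.comp
    (primrec_numeralWord.comp Primrec.snd) <| Primrec.list_append.comp (Primrec.const _) <|
      Primrec.list_append.comp Primrec.fst (Primrec.const _)).to₂

open Turing

/-! ### Turing machines and primitive recursion -/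

section Simulation

variable {A Λ : Type} [Inhabited Λ]

/-- The letters on a half-tape, without the blanks. -/
def halfContent (l : ListBlank (Option A)) : List A :=
  l.liftOn List.reduceOption <| by
    rintro a _ ⟨n, rfl⟩
    have : (List.replicate n (default : Option A)).reduceOption = [] :=
      List.reduceOption_replicate_none
    rw [List.reduceOption_append, this, List.append_nil]

/-- The letters on a tape, from left to right, without the blanks. -/
def content (T : Tape (Option A)) : List A :=
  (halfContent T.left).reverse ++ halfContent T.right₀

lemma halfContent_cons (a : Option A) (l : ListBlank (Option A)) :
    halfContent (l.cons a) = a.toList ++ halfContent l := by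
  induction l using ListBlank.induction_on with
  | h l => cases a <;> rfl

lemma content_mk' (L R : ListBlank (Option A)) :
    content (Tape.mk' L R) = (halfContent L).reverse ++ halfContent R := by
  rw [content, Tape.mk'_right₀, Tape.mk'_left]

lemma content_move (d : Dir) (T : Tape (Option A)) : content (T.move d) = content T := by
  obtain ⟨L, R, rfl⟩ := T.exists_mk'
  obtain ⟨a, L, rfl⟩ := L.exists_cons
  obtain ⟨b, R, rfl⟩ := R.exists_cons
  have hrev : ∀ o : Option A, o.toList.reverse = o.toList := by rintro (_ | _) <;> rfl
  cases d <;> simp [content_mk', halfContent_cons, hrev]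

/-- Since `content` is invariant under head moves, it may be read off with the head on the first
letter. -/
lemma content_of_shows {T : Tape (Option A)} {w : List A} (h : Shows T w) : content T = w := by
  obtain ⟨d, n, h⟩ := h
  have : ∀ n, content ((Tape.move d)^[n] T) = content T := by
    intro n
    induction n with
    | zero => rfl
    | succ n ih => rw [Function.iterate_succ_apply', content_move, ih]
  rw [← this n, h, Tape.mk₁, Tape.mk₂, content_mk']
  have : ∀ w : List A, (w.map some).reduceOption = w := fun w => by
    simp [List.reduceOption, List.filterMap_map]
  exact this w

variable (M : TM0.Machine (Option A) Λ)

/-- The next configuration, where a tape is represented by the list of the cells to the left of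
the head and the list of the remaining cells. A configuration in which the machine stops does not
change any more. -/
def listStep (c : Λ × List (Option A) × List (Option A)) : Λ × List (Option A) × List (Option A) :=
  match M c.1 c.2.2.headI with
  | none => c
  | some (q, TM0.Stmt.move Dir.left) => (q, c.2.1.tail, c.2.1.headI :: c.2.2)
  | some (q, TM0.Stmt.move Dir.right) => (q, c.2.2.headI :: c.2.1, c.2.2.tail)
  | some (q, TM0.Stmt.write a) => (q, c.2.1, a :: c.2.2.tail)

/-- The configuration represented by a state and two lists. -/
def ofLists (c : Λ × List (Option A) × List (Option A)) : TM0.Cfg (Option A) Λ :=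
  ⟨c.1, Tape.mk₂ c.2.1 c.2.2⟩

lemma step_ofLists (c : Λ × List (Option A) × List (Option A)) :
    TM0.step M (ofLists c) =
      if (M c.1 c.2.2.headI).isSome then some (ofLists (listStep M c)) else none := by
  obtain ⟨q, L, R⟩ := c
  have : ∀ R : List (Option A), (Tape.mk₂ L R).head = R.headI := fun _ => rfl
  rw [TM0.step, ofLists, listStep]
  simp only [this]
  rcases M q R.headI with _ | ⟨q', (_ | _) | a⟩
  · rfl
  · simp [ofLists, Tape.mk₂]
  · simp [ofLists, Tape.mk₂]
  · simp [ofLists, Tape.mk₂]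

lemma listStep_of_isNone {c : Λ × List (Option A) × List (Option A)}
    (h : ¬ (M c.1 c.2.2.headI).isSome) : listStep M c = c := by
  rw [Option.not_isSome_iff_eq_none] at h
  simp [listStep, h]

/-- The machine gives the answer `u` when started on the word `w`. -/
def Answers (w u : List A) : Prop :=
  ∃ k : ℕ, ¬ (M ((listStep M)^[k] (default, [], w.map some)).1
      ((listStep M)^[k] (default, [], w.map some)).2.2.headI).isSome ∧
    ((listStep M)^[k] (default, [], w.map some)).2.1.reduceOption.reverse ++
      ((listStep M)^[k] (default, [], w.map some)).2.2.reduceOption = u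

/-- Lists of cells simulate the tape step by step, which replaces tapes by data to which primitive
recursion applies. -/
lemma answers_of_outputs {w u : List A} (h : Outputs M w u) : Answers M w u := by
  obtain ⟨c, hr, hs, hc⟩ := h
  have : ∃ k, c = ofLists ((listStep M)^[k] (default, [], w.map some)) := by
    clear hs hc
    induction hr with
    | refl => exact ⟨0, rfl⟩
    | tail _ hbc ih =>
      obtain ⟨k, rfl⟩ := ih
      refine ⟨k + 1, ?_⟩
      rw [Function.iterate_succ_apply']
      rw [step_ofLists] at hbc
      split_ifs at hbc with hm
      · exact (Option.some.inj hbc).symm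
      · cases hbc
  obtain ⟨k, rfl⟩ := this
  refine ⟨k, ?_, ?_⟩
  · intro hm
    rw [step_ofLists, if_pos hm] at hs
    cases hs
  · rw [← content_of_shows hc]
    exact (content_mk' (ListBlank.mk _) (ListBlank.mk _)).symm

/-- A stopped configuration is a fixed point of `listStep`, so two stopped runs on the same input
end alike. -/
lemma Answers.unique {w u u' : List A} (h : Answers M w u) (h' : Answers M w u') : u = u' := by
  obtain ⟨k, hk, rfl⟩ := h
  obtain ⟨k', hk', rfl⟩ := h'
  have hfix : ∀ {k}, ¬ (M ((listStep M)^[k] (default, [], w.map some)).1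
      ((listStep M)^[k] (default, [], w.map some)).2.2.headI).isSome → ∀ j,
      (listStep M)^[j + k] (default, [], w.map some) =
        (listStep M)^[k] (default, [], w.map some) := by
    intro k hk j
    rw [Function.iterate_add_apply]
    exact Function.iterate_fixed (listStep_of_isNone M hk) j
  have : (listStep M)^[k] (default, [], w.map some) =
      (listStep M)^[k'] (default, [], w.map some) := by
    rw [← hfix hk k', ← hfix hk' k, add_comm]
  rw [this]

end Simulation

lemma primrec_reduceOption {A : Type} [Primcodable A] : Primrec (List.reduceOption : List (Option A) → List A) :=
  (Primrec.listFilterMap Primrec.id (Primrec.snd (α := List (Option A)) (β := Option A)).to₂).of_eq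
    fun _ => rfl

/-! ### Machine runs are arithmetical; undecidability -/

section Primrec

variable {A Λ : Type} [Finite A] [Finite Λ] [Inhabited Λ] [Primcodable A] [Primcodable Λ]
  (M : TM0.Machine (Option A) Λ)

open Primrec

/-- The transition table is a function on a finite type, hence primitive recursive; the rest is a
case distinction and list operations. -/
lemma primrec_listStep : Primrec (listStep M) := by
  have hL : Primrec fun c : Λ × List (Option A) × List (Option A) => c.2.1 := fst.comp snd
  have hR : Primrec fun c : Λ × List (Option A) × List (Option A) => c.2.2 := snd.comp snd
  have hkey : Primrec fun c : Λ × List (Option A) × List (Option A) => (c.1, c.2.2.headI) :=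
    fst.pair (list_headI.comp hR)
  let kind : Λ × Option A → ℕ := fun x => match M x.1 x.2 with
    | none => 0
    | some (_, TM0.Stmt.move Dir.left) => 1
    | some (_, TM0.Stmt.move Dir.right) => 2
    | some (_, TM0.Stmt.write _) => 3
  let state : Λ × Option A → Λ := fun x => match M x.1 x.2 with
    | none => x.1
    | some (q, _) => q
  let letter : Λ × Option A → Option A := fun x => match M x.1 x.2 with
    | some (_, TM0.Stmt.write a) => a
    | _ => none
  have hkind : ∀ n, PrimrecPred fun c : Λ × List (Option A) × List (Option A) =>
      kind (c.1, c.2.2.headI) = n := fun n =>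
    Primrec.eq.comp ((dom_finite kind).comp hkey) (Primrec.const n)
  have hstate := (dom_finite state).comp hkey
  have hletter := (dom_finite letter).comp hkey
  refine (Primrec.ite (hkind 0) Primrec.id <| Primrec.ite (hkind 1)
    (hstate.pair ((list_tail.comp hL).pair (list_cons.comp (list_headI.comp hL) hR))) <|
    Primrec.ite (hkind 2)
      (hstate.pair ((list_cons.comp (list_headI.comp hR) hL).pair (list_tail.comp hR))) <|
    hstate.pair (hL.pair (list_cons.comp hletter (list_tail.comp hR)))).of_eq ?_
  rintro ⟨q, L, R⟩
  simp only [kind, state, letter, listStep]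
  rcases M q R.headI with _ | ⟨q', (_ | _) | a⟩ <;> rfl

/-- The relation that a machine gives a fixed answer on a primitive recursive input is
arithmetical. -/
theorem arithmetical_answers {f : ℕ → List A} (hf : Primrec f) (u : List A) :
    Arithmetical fun v : Fin 1 → ℕ => Answers M (f (v 0)) u := by
  -- Only the number `k` of steps is unbounded; the configuration after `k` steps is primitive
  -- recursive in the input and `k`.
  refine Arithmetical.ex (Arithmetical.of_primrecPred₂ (p := fun n k =>
    ¬ (M ((listStep M)^[k] (default, [], (f n).map some)).1
      ((listStep M)^[k] (default, [], (f n).map some)).2.2.headI).isSome ∧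
    ((listStep M)^[k] (default, [], (f n).map some)).2.1.reduceOption.reverse ++
      ((listStep M)^[k] (default, [], (f n).map some)).2.2.reduceOption = u) ?_ (.var _) (.var _))
  have hrun : Primrec fun x : ℕ × ℕ => (listStep M)^[x.2] (default, [], (f x.1).map some) :=
    nat_iterate snd ((Primrec.const _).pair ((Primrec.const _).pair
      (list_map (hf.comp fst) (option_some.comp snd).to₂))) ((primrec_listStep M).comp snd).to₂
  have hL := fst.comp (snd.comp hrun)
  have hR := snd.comp (snd.comp hrun)
  have hhalt : PrimrecPred fun x : Λ × Option A => (M x.1 x.2).isSome = true :=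
    Primrec.eq.comp (dom_finite _) (Primrec.const true)
  exact (hhalt.comp ((fst.comp hrun).pair (list_headI.comp hR))).not.and
    (Primrec.eq.comp (list_append.comp (list_reverse.comp (primrec_reduceOption.comp hL))
      (primrec_reduceOption.comp hR)) (Primrec.const u))

end Primrec

/-- The theory of a semiring in which all arithmetical sets of natural numbers are definable is
undecidable. -/
theorem not_decidableTheory {R : Type} [CommSemiring R]
    (hR : ∀ P : (Fin 1 → ℕ) → Prop, Arithmetical P → ∃ φ : arith.BoundedFormula Empty 1, ∀ n : ℕ,
      φ.Realize default (fun _ => (n : R)) ↔ P fun _ => n) :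
    ¬ DecidableTheory (arith.completeTheory R) := by
  rintro ⟨A, Λ, _, _, _, M, e, yes, no, hne, hM⟩
  let _ : Primcodable A := primcodableOfFinite A
  let _ : Primcodable Λ := primcodableOfFinite Λ
  let word : ℕ → List Letter := fun n => (Encodable.decode n).getD []
  have hword : Primrec word := Primrec.option_getD.comp Primrec.decode (Primrec.const [])
  obtain ⟨φ, hφ⟩ := hR _ (arithmetical_answers M
    (Primrec.list_map (primrec_atNumeralWord.comp hword Primrec.id)
      ((Primrec.dom_finite e).comp Primrec.snd).to₂) no)
  -- Diagonalisation: `φ` is applied to the code of its own word, so `φ(n)` says that `M` answers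
  -- `no` on the sentence `atNumeral φ n`.
  set n := Encodable.encode (formulaWord φ) with hn
  have hw : (atNumeralWord (word n) n) = sentenceWord (atNumeral φ n) := by
    simp [word, hn, sentenceWord_atNumeral]
  have hφn := (realize_atNumeral (R := R) φ n).trans (hφ n)
  simp only [id] at hφn
  rw [hw] at hφn
  obtain ⟨hyes, hno⟩ := hM (atNumeral φ n)
  by_cases h : R ⊨ atNumeral φ n
  · exact hne ((answers_of_outputs M (hyes h)).unique M (hφn.1 h))
  · exact h (hφn.2 (answers_of_outputs M (hno h)))

theorem not_decidableTheory_nat : ¬ DecidableTheory (arith.completeTheory ℕ) :=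
  not_decidableTheory fun P hP => by
    obtain ⟨φ, hφ⟩ := hP.exists_boundedFormula
    exact ⟨φ, fun n => by convert hφ fun _ => n; rfl⟩

theorem not_decidableTheory_int : ¬ DecidableTheory (arith.completeTheory ℤ) :=
  not_decidableTheory fun P hP => by
    obtain ⟨φ, hφ⟩ := hP.exists_boundedFormula
    obtain ⟨ψ, hψ⟩ := exists_formula_int φ
    exact ⟨ψ, fun n => by convert (hψ fun _ => n).trans (hφ _)⟩

/-! ### Models of Peano arithmetic -/

section Operations

variable {M : Type} [arith.Structure M]

variable (M) in
/-- The interpretation of `0`. -/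
def zeroOf : M := Structure.funMap (L := arith) ArithFunc.zero ![]

variable (M) in
/-- The interpretation of `1`. -/
def oneOf : M := Structure.funMap (L := arith) ArithFunc.one ![]

/-- The interpretation of `+`. -/
def addOf (x y : M) : M := Structure.funMap (L := arith) ArithFunc.add ![x, y]

/-- The interpretation of `·`. -/
def mulOf (x y : M) : M := Structure.funMap (L := arith) ArithFunc.mul ![x, y]

variable {α : Type} (v : α → M)

lemma term_realize_zero : (0 : arith.Term α).realize v = zeroOf M :=
  congrArg (Structure.funMap (L := arith) ArithFunc.zero) (Subsingleton.elim _ _)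

lemma term_realize_one : (1 : arith.Term α).realize v = oneOf M :=
  congrArg (Structure.funMap (L := arith) ArithFunc.one) (Subsingleton.elim _ _)

lemma term_realize_add (s t : arith.Term α) :
    (s + t).realize v = addOf (s.realize v) (t.realize v) :=
  Term.realize_functions_apply₂

lemma term_realize_mul (s t : arith.Term α) :
    (s * t).realize v = mulOf (s.realize v) (t.realize v) :=
  Term.realize_functions_apply₂

variable (M) in
/-- The Peano axioms, as properties of a structure. -/
structure PeanoLaws : Prop where
  succ_ne_zero (x : M) : addOf x (oneOf M) ≠ zeroOf M
  succ_inj (x y : M) : addOf x (oneOf M) = addOf y (oneOf M) → x = y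
  add_zero (x : M) : addOf x (zeroOf M) = x
  add_succ (x y : M) : addOf x (addOf y (oneOf M)) = addOf (addOf x y) (oneOf M)
  mul_zero (x : M) : mulOf x (zeroOf M) = zeroOf M
  mul_succ (x y : M) : mulOf x (addOf y (oneOf M)) = addOf (mulOf x y) x
  induction (n : ℕ) (φ : arith.BoundedFormula Empty (n + 1)) (a : Fin n → M) :
    φ.Realize default (Fin.snoc a (zeroOf M)) →
    (∀ x, φ.Realize default (Fin.snoc a x) →
      φ.Realize default (Fin.snoc a (addOf x (oneOf M)))) →
    ∀ x, φ.Realize default (Fin.snoc a x)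

lemma realize_substLast {n m : ℕ} (h : n ≤ m) (φ : arith.Formula (Fin (n + 1)))
    (t : arith.Term (Fin m)) (v : Empty → M) (a : Fin m → M) :
    (substLast h φ t).Realize v a ↔
      φ.Realize (Fin.snoc (fun i => a (Fin.castLE h i)) (t.realize a) : Fin (n + 1) → M) := by
  rw [substLast]
  refine (Formula.realize_relabel_sumInr _).trans (BoundedFormula.realize_subst.trans ?_)
  rw [Formula.Realize]
  have : (fun i => Term.realize a (Fin.snoc (α := fun _ => arith.Term (Fin m))
      (fun i => Term.var (Fin.castLE h i)) t i)) =
      (Fin.snoc (fun i => a (Fin.castLE h i)) (t.realize a) : Fin (n + 1) → M) := by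
    funext i
    refine Fin.lastCases ?_ (fun i => ?_) i <;> simp
  rw [this]

lemma realize_inductionAxiom {n : ℕ} (φ : arith.Formula (Fin (n + 1))) :
    M ⊨ inductionAxiom φ ↔ ∀ a : Fin n → M, φ.Realize (Fin.snoc a (zeroOf M) : Fin (n + 1) → M) →
      (∀ x, φ.Realize (Fin.snoc a x : Fin (n + 1) → M) →
        φ.Realize (Fin.snoc a (addOf x (oneOf M)) : Fin (n + 1) → M)) →
      ∀ x, φ.Realize (Fin.snoc a x : Fin (n + 1) → M) := by
  have hsnoc : ∀ (a : Fin n → M) (x : M) (h : n ≤ n + 1),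
      (fun i => (Fin.snoc a x : Fin (n + 1) → M) (Fin.castLE h i)) = a := by
    intro a x h
    funext i
    exact Fin.snoc_castSucc (α := fun _ => M) ..
  refine (BoundedFormula.realize_alls (v := default)).trans ?_
  simp only [BoundedFormula.realize_imp, BoundedFormula.realize_all, realize_substLast,
    term_realize_zero, term_realize_add, term_realize_one, Term.realize_var, Fin.snoc_last, hsnoc]
  rfl

/-- This passes between the two presentations of a formula in `k` variables: the axiom scheme uses
`arith.Formula (Fin k)`, the coding uses `arith.BoundedFormula Empty k`. -/
lemma realize_toFormula_relabel {k : ℕ} (φ : arith.BoundedFormula Empty k) (v : Fin k → M) :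
    (φ.toFormula.relabel (Sum.elim Empty.elim id)).Realize v ↔ φ.Realize default v := by
  rw [Formula.realize_relabel, BoundedFormula.realize_toFormula]
  have h : (v ∘ (Sum.elim Empty.elim id : Empty ⊕ Fin k → Fin k)) ∘ Sum.inl = default :=
    Subsingleton.elim _ _
  rw [h]
  rfl

/-- The models of Peano arithmetic are the structures that satisfy the Peano axioms. -/
theorem model_peano_iff : M ⊨ peano ↔ PeanoLaws M := by
  rw [Theory.model_iff]
  have h1 : ∀ {P : (Fin 1 → M) → Prop}, (∀ v, P v) ↔ ∀ x, P ![x] := fun {P} =>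
    ⟨fun h x => h _, fun h v => by
      rw [show v = ![v 0] from List.ofFn_inj.mp rfl]
      exact h _⟩
  have h2 : ∀ {P : (Fin 2 → M) → Prop}, (∀ v, P v) ↔ ∀ x y, P ![x, y] := fun {P} =>
    ⟨fun h x y => h _, fun h v => by
      rw [show v = ![v 0, v 1] from List.ofFn_inj.mp rfl]
      exact h _ _⟩
  have hax : ∀ {n : ℕ} (φ : arith.BoundedFormula Empty n),
      M ⊨ (φ.alls : arith.Sentence) ↔ ∀ a, φ.Realize default a := fun φ =>
    BoundedFormula.realize_alls
  constructor
  · intro h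
    constructor
    · simpa [hax, h1, term_realize_add, term_realize_zero, term_realize_one, bvar]
        using h _ IsPeanoAxiom.succ_ne_zero
    · simpa [hax, h2, term_realize_add, term_realize_zero, term_realize_one, bvar]
        using h _ IsPeanoAxiom.succ_inj
    · simpa [hax, h1, term_realize_add, term_realize_zero, term_realize_one, bvar]
        using h _ IsPeanoAxiom.add_zero
    · simpa [hax, h2, term_realize_add, term_realize_zero, term_realize_one, bvar]
        using h _ IsPeanoAxiom.add_succ
    · simpa [hax, h1, term_realize_mul, term_realize_zero, term_realize_one, bvar]
        using h _ IsPeanoAxiom.mul_zero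
    · simpa [hax, h2, term_realize_mul, term_realize_add, term_realize_one, bvar]
        using h _ IsPeanoAxiom.mul_succ
    · intro n φ
      simpa only [realize_toFormula_relabel] using (realize_inductionAxiom _).1
        (h _ (IsPeanoAxiom.induction n (φ.toFormula.relabel (Sum.elim Empty.elim id))))
  · rintro h _ (_ | _ | _ | _ | _ | _ | ⟨n, φ⟩)
    · simpa [hax, h1, term_realize_add, term_realize_zero, term_realize_one, bvar]
        using h.succ_ne_zero
    · simpa [hax, h2, term_realize_add, term_realize_zero, term_realize_one, bvar]
        using h.succ_inj
    · simpa [hax, h1, term_realize_add, term_realize_zero, term_realize_one, bvar]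
        using h.add_zero
    · simpa [hax, h2, term_realize_add, term_realize_zero, term_realize_one, bvar]
        using h.add_succ
    · simpa [hax, h1, term_realize_mul, term_realize_zero, term_realize_one, bvar]
        using h.mul_zero
    · simpa [hax, h2, term_realize_mul, term_realize_add, term_realize_one, bvar]
        using h.mul_succ
    · rw [realize_inductionAxiom]
      have := h.induction n (BoundedFormula.relabel (n := n + 1) (k := 0) Sum.inr φ)
      intro a h0 hs x
      exact (Formula.realize_relabel_sumInr φ).1 (this a ((Formula.realize_relabel_sumInr φ).2 h0)
        (fun x hx => (Formula.realize_relabel_sumInr φ).2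
          (hs x ((Formula.realize_relabel_sumInr φ).1 hx))) x)

end Operations

lemma peanoLaws_nat : PeanoLaws ℕ where
  succ_ne_zero := Nat.succ_ne_zero
  succ_inj _ _ := Nat.succ.inj
  add_zero _ := rfl
  add_succ _ _ := rfl
  mul_zero := Nat.mul_zero
  mul_succ := Nat.mul_succ
  induction _ _ _ h0 hs x := Nat.rec h0 hs x

instance : ℕ ⊨ peano := model_peano_iff.2 peanoLaws_nat

/-! ### Codes of terms and formulas -/

/-- A nonzero tag makes the code larger than its contents, so recursion on codes terminates. -/
lemma snd_lt_pair {a b : ℕ} (ha : a ≠ 0) : b < Nat.pair a b := by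
  unfold Nat.pair
  split_ifs with h
  · nlinarith [Nat.le_mul_self b, Nat.pos_of_ne_zero ha]
  · have := Nat.pos_of_ne_zero ha
    omega

lemma unpair_snd_lt {t : ℕ} (ht : t.unpair.1 ≠ 0) : t.unpair.2 < t := by
  simpa using snd_lt_pair (b := t.unpair.2) ht

/-- The code of the variable number `i`. -/
def tVar (i : ℕ) : ℕ := Nat.pair 0 i
/-- The code of `0`. -/
def tZero : ℕ := Nat.pair 1 0
/-- The code of `1`. -/
def tOne : ℕ := Nat.pair 2 0
/-- The code of the sum of two terms. -/
def tAdd (s t : ℕ) : ℕ := Nat.pair 3 (Nat.pair s t)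
/-- The code of the product of two terms. -/
def tMul (s t : ℕ) : ℕ := Nat.pair 4 (Nat.pair s t)
/-- The code of `⊥`. -/
def fBot : ℕ := Nat.pair 0 0
/-- The code of an equation. -/
def fEq (s t : ℕ) : ℕ := Nat.pair 1 (Nat.pair s t)
/-- The code of an implication. -/
def fImp (c d : ℕ) : ℕ := Nat.pair 2 (Nat.pair c d)
/-- The code of a universal formula. -/
def fAll (c : ℕ) : ℕ := Nat.pair 3 c

/-- The code of a term. -/
def encT {n : ℕ} : arith.Term (Empty ⊕ Fin n) → ℕ
  | Term.var (Sum.inr i) => tVar i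
  | Term.func ArithFunc.zero _ => tZero
  | Term.func ArithFunc.one _ => tOne
  | Term.func ArithFunc.add ts => tAdd (encT (ts 0)) (encT (ts 1))
  | Term.func ArithFunc.mul ts => tMul (encT (ts 0)) (encT (ts 1))

/-- The code of a formula. -/
def encF : {n : ℕ} → arith.BoundedFormula Empty n → ℕ
  | _, BoundedFormula.falsum => fBot
  | _, BoundedFormula.equal s t => fEq (encT s) (encT t)
  | _, BoundedFormula.imp φ ψ => fImp (encF φ) (encF ψ)
  | _, BoundedFormula.all φ => fAll (encF φ)

/-- The term in `n` variables with the code `t`. -/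
def decT (n t : ℕ) : arith.Term (Empty ⊕ Fin n) :=
  if h : t.unpair.1 = 0 then
    -- Decoding is total: a variable out of range becomes `0`, and tags above 4 are read as
    -- products.
    if hi : t.unpair.2 < n then Term.var (Sum.inr ⟨t.unpair.2, hi⟩) else 0
  else
    have := unpair_snd_lt h
    have := Nat.unpair_left_le t.unpair.2
    have := Nat.unpair_right_le t.unpair.2
    if t.unpair.1 = 1 then 0
    else if t.unpair.1 = 2 then 1
    else if t.unpair.1 = 3 then
      decT n t.unpair.2.unpair.1 + decT n t.unpair.2.unpair.2
    else decT n t.unpair.2.unpair.1 * decT n t.unpair.2.unpair.2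
termination_by t
decreasing_by all_goals omega

/-- The formula in `n` variables with the code `c`. -/
def decF (n c : ℕ) : arith.BoundedFormula Empty n :=
  if h : c.unpair.1 = 0 then ⊥
  else
    have := unpair_snd_lt h
    have := Nat.unpair_left_le c.unpair.2
    have := Nat.unpair_right_le c.unpair.2
    if c.unpair.1 = 1 then
      (decT n c.unpair.2.unpair.1).bdEqual (decT n c.unpair.2.unpair.2)
    else if c.unpair.1 = 2 then
      (decF n c.unpair.2.unpair.1).imp (decF n c.unpair.2.unpair.2)
    else (decF (n + 1) c.unpair.2).all
termination_by c
decreasing_by all_goals omega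

section Decode

variable (n s t c d : ℕ)

lemma decT_tVar (i : Fin n) : decT n (tVar i) = Term.var (Sum.inr i) := by
  rw [decT]; simp [tVar]

lemma decT_tZero : decT n tZero = 0 := by
  rw [decT]; simp [tZero]

lemma decT_tOne : decT n tOne = 1 := by
  rw [decT]; simp [tOne]

lemma decT_tAdd : decT n (tAdd s t) = decT n s + decT n t := by
  rw [decT]; simp [tAdd]

lemma decT_tMul : decT n (tMul s t) = decT n s * decT n t := by
  rw [decT]; simp [tMul]

lemma decF_fBot : decF n fBot = ⊥ := by
  rw [decF]; simp [fBot]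

lemma decF_fEq : decF n (fEq s t) = (decT n s).bdEqual (decT n t) := by
  rw [decF]; simp [fEq]

lemma decF_fImp : decF n (fImp c d) = (decF n c).imp (decF n d) := by
  rw [decF]; simp [fImp]

lemma decF_fAll : decF n (fAll c) = (decF (n + 1) c).all := by
  rw [decF]; simp [fAll]

end Decode

lemma func_add_eq {α : Type} (ts : Fin 2 → arith.Term α) :
    (Term.func (L := arith) ArithFunc.add ts : arith.Term α) = ts 0 + ts 1 :=
  congrArg (Term.func (L := arith) ArithFunc.add) (List.ofFn_inj.mp rfl)

lemma func_mul_eq {α : Type} (ts : Fin 2 → arith.Term α) :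
    (Term.func (L := arith) ArithFunc.mul ts : arith.Term α) = ts 0 * ts 1 :=
  congrArg (Term.func (L := arith) ArithFunc.mul) (List.ofFn_inj.mp rfl)

lemma decT_encT {n : ℕ} (t : arith.Term (Empty ⊕ Fin n)) : decT n (encT t) = t := by
  induction t with
  | var i =>
    rcases i with i | i
    · exact i.elim
    · rw [encT, decT_tVar]
  | func f ts ih =>
    cases f with
    | zero =>
      rw [encT, decT_tZero]
      exact congrArg (Term.func (L := arith) ArithFunc.zero) (Subsingleton.elim _ _)
    | one =>
      rw [encT, decT_tOne]
      exact congrArg (Term.func (L := arith) ArithFunc.one) (Subsingleton.elim _ _)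
    | add => rw [encT, decT_tAdd, ih, ih, func_add_eq]
    | mul => rw [encT, decT_tMul, ih, ih, func_mul_eq]

lemma decF_encF {n : ℕ} (φ : arith.BoundedFormula Empty n) : decF n (encF φ) = φ := by
  induction φ with
  | falsum => exact decF_fBot _
  | equal s t => rw [encF, decF_fEq, decT_encT, decT_encT]; rfl
  | rel r => exact r.elim
  | imp φ ψ ihφ ihψ => rw [encF, decF_fImp, ihφ, ihψ]
  | all φ ih => rw [encF, decF_fAll, ih]

/-! ### Codes of environments and of elements of a Henkin model -/

/-- The values of the `n` variables in the environment with the code `a`. -/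
def env : (n a : ℕ) → Fin n → ℕ
  | 0, _ => Fin.elim0
  | n + 1, a => Fin.snoc (env n a.unpair.1) a.unpair.2

lemma env_le (n a : ℕ) (i : Fin n) : env n a i ≤ a := by
  induction n generalizing a with
  | zero => exact i.elim0
  | succ n ih =>
    refine Fin.lastCases ?_ (fun i => ?_) i
    · simpa [env] using Nat.unpair_right_le a
    · simpa [env] using (ih _ i).trans (Nat.unpair_left_le a)

lemma env_succ_pair (n a d : ℕ) : env (n + 1) (Nat.pair a d) = Fin.snoc (env n a) d := by
  simp [env]

lemma exists_env {n : ℕ} (v : Fin n → ℕ) : ∃ a, env n a = v := by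
  induction n with
  | zero => exact ⟨0, Subsingleton.elim _ _⟩
  | succ n ih =>
    obtain ⟨a, ha⟩ := ih (Fin.init v)
    exact ⟨Nat.pair a (v (Fin.last n)), by rw [env_succ_pair, ha, Fin.snoc_init_self]⟩

/-- The code of the value of the term `t` in the environment `a`. -/
def clo (n t a : ℕ) : ℕ := Nat.pair 1 (Nat.pair n (Nat.pair t a))
/-- The code of a counterexample to `∀ x, c(a, x)`. -/
def wit (n c a : ℕ) : ℕ := Nat.pair 2 (Nat.pair n (Nat.pair c a))
/-- The code of an `x` with `c(a, x)` and not `c(a, x + 1)`. -/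
def ind (n c a : ℕ) : ℕ := Nat.pair 3 (Nat.pair n (Nat.pair c a))
/-- The code of the element `0`. -/
def zeroD : ℕ := clo 0 tZero 0
/-- The code of the element `1`. -/
def oneD : ℕ := clo 0 tOne 0
/-- The code of the sum of two elements. -/
def addD (d e : ℕ) : ℕ := clo 2 (tAdd (tVar 0) (tVar 1)) (Nat.pair (Nat.pair 0 d) e)
/-- The code of the product of two elements. -/
def mulD (d e : ℕ) : ℕ := clo 2 (tMul (tVar 0) (tVar 1)) (Nat.pair (Nat.pair 0 d) e)
/-- The code of the statement that two elements are equal. -/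
def kE (d e : ℕ) : ℕ := Nat.pair 0 (Nat.pair d e)
/-- The code of the statement that a formula in `n` variables is true in an environment. -/
def kS (n c a : ℕ) : ℕ := Nat.pair 1 (Nat.pair n (Nat.pair c a))

section Value

variable (M : Type) [arith.Structure M] [Nonempty M]

open Classical in
/-- The element of the model `M` with the code `d`. -/
noncomputable def val (d : ℕ) : M :=
  -- Tag 0 names nothing, so the value is a default; every number must denote an element, and tags
  -- above 3 are read like `ind`.
  if h : d.unpair.1 = 0 then zeroOf M
  else
    let ρ : Fin d.unpair.2.unpair.1 → M := fun i =>
      have := unpair_snd_lt h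
      have := Nat.unpair_right_le d.unpair.2
      have := Nat.unpair_right_le d.unpair.2.unpair.2
      have := env_le d.unpair.2.unpair.1 d.unpair.2.unpair.2.unpair.2 i
      val (env d.unpair.2.unpair.1 d.unpair.2.unpair.2.unpair.2 i)
    let φ := decF (d.unpair.2.unpair.1 + 1) d.unpair.2.unpair.2.unpair.1
    if d.unpair.1 = 1 then
      (decT d.unpair.2.unpair.1 d.unpair.2.unpair.2.unpair.1).realize (Sum.elim default ρ)
    else if d.unpair.1 = 2 then
      Classical.epsilon fun x => ¬ φ.Realize default (Fin.snoc ρ x)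
    else
      Classical.epsilon fun x => φ.Realize default (Fin.snoc ρ x) ∧
        ¬ φ.Realize default (Fin.snoc ρ (addOf x (oneOf M)))
termination_by d
decreasing_by omega

/-- The values in the model `M` of the variables in the environment with the code `a`. -/
noncomputable def envVal (n a : ℕ) : Fin n → M := fun i => val M (env n a i)

lemma envVal_succ_pair (n a d : ℕ) :
    envVal M (n + 1) (Nat.pair a d) = Fin.snoc (envVal M n a) (val M d) := by
  funext i
  simp only [envVal, env_succ_pair]
  refine Fin.lastCases ?_ (fun i => ?_) i
  · simp
  · simp [envVal]

lemma val_clo (n t a : ℕ) :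
    val M (clo n t a) = (decT n t).realize (Sum.elim default (envVal M n a)) := by
  rw [val, dif_neg (by simp [clo]), if_pos (by simp [clo])]
  -- The arity occurs in types, so the decoded pair is replaced by generalising and substituting.
  have key : ∀ p : ℕ, p = Nat.pair n (Nat.pair t a) →
      (decT p.unpair.1 p.unpair.2.unpair.1).realize (Sum.elim default
        fun i => val M (env p.unpair.1 p.unpair.2.unpair.2 i)) =
      (decT n t).realize (Sum.elim default (envVal M n a)) := by
    rintro p rfl
    generalize h : Nat.unpair (Nat.pair n (Nat.pair t a)) = q
    rw [Nat.unpair_pair] at h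
    subst h
    simp only [Nat.unpair_pair]
    rfl
  exact key _ (by simp [clo])

lemma val_wit (n c a : ℕ) : val M (wit n c a) = Classical.epsilon fun x =>
    ¬ (decF (n + 1) c).Realize default (Fin.snoc (envVal M n a) x) := by
  rw [val, dif_neg (by simp [wit]), if_neg (by simp [wit]), if_pos (by simp [wit])]
  have key : ∀ p : ℕ, p = Nat.pair n (Nat.pair c a) →
      (Classical.epsilon fun x => ¬ (decF (p.unpair.1 + 1) p.unpair.2.unpair.1).Realize default
        (Fin.snoc (fun i => val M (env p.unpair.1 p.unpair.2.unpair.2 i)) x)) =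
      Classical.epsilon fun x =>
        ¬ (decF (n + 1) c).Realize default (Fin.snoc (envVal M n a) x) := by
    rintro p rfl
    generalize h : Nat.unpair (Nat.pair n (Nat.pair c a)) = q
    rw [Nat.unpair_pair] at h
    subst h
    simp only [Nat.unpair_pair]
    rfl
  exact key _ (by simp [wit])

lemma val_ind (n c a : ℕ) : val M (ind n c a) = Classical.epsilon fun x =>
    (decF (n + 1) c).Realize default (Fin.snoc (envVal M n a) x) ∧
      ¬ (decF (n + 1) c).Realize default (Fin.snoc (envVal M n a) (addOf x (oneOf M))) := by
  rw [val, dif_neg (by simp [ind]), if_neg (by simp [ind]), if_neg (by simp [ind])]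
  have key : ∀ p : ℕ, p = Nat.pair n (Nat.pair c a) →
      (Classical.epsilon fun x => (decF (p.unpair.1 + 1) p.unpair.2.unpair.1).Realize default
          (Fin.snoc (fun i => val M (env p.unpair.1 p.unpair.2.unpair.2 i)) x) ∧
        ¬ (decF (p.unpair.1 + 1) p.unpair.2.unpair.1).Realize default
          (Fin.snoc (fun i => val M (env p.unpair.1 p.unpair.2.unpair.2 i))
            (addOf x (oneOf M)))) =
      Classical.epsilon fun x =>
        (decF (n + 1) c).Realize default (Fin.snoc (envVal M n a) x) ∧
          ¬ (decF (n + 1) c).Realize default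
            (Fin.snoc (envVal M n a) (addOf x (oneOf M))) := by
    rintro p rfl
    generalize h : Nat.unpair (Nat.pair n (Nat.pair c a)) = q
    rw [Nat.unpair_pair] at h
    subst h
    simp only [Nat.unpair_pair]
    rfl
  exact key _ (by simp [ind])

lemma val_zeroD : val M zeroD = zeroOf M := by
  rw [zeroD, val_clo, decT_tZero, term_realize_zero]

lemma val_oneD : val M oneD = oneOf M := by
  rw [oneD, val_clo, decT_tOne, term_realize_one]

lemma decT_two_tVar_zero : decT 2 (tVar 0) = Term.var (Sum.inr 0) := decT_tVar 2 0

lemma decT_two_tVar_one : decT 2 (tVar 1) = Term.var (Sum.inr 1) := decT_tVar 2 1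

lemma val_addD (d e : ℕ) : val M (addD d e) = addOf (val M d) (val M e) := by
  rw [addD, val_clo, decT_tAdd, term_realize_add, decT_two_tVar_zero, decT_two_tVar_one,
    envVal_succ_pair, envVal_succ_pair]
  rfl

lemma val_mulD (d e : ℕ) : val M (mulD d e) = mulOf (val M d) (val M e) := by
  rw [mulD, val_clo, decT_tMul, term_realize_mul, decT_two_tVar_zero, decT_two_tVar_one,
    envVal_succ_pair, envVal_succ_pair]
  rfl

end Value

/-! ### Henkin models of Peano arithmetic -/

/-- The closure conditions on a set `X` of codes of statements that ensure that `X` describes a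
model of Peano arithmetic in which the sentence with the code `s` is false. -/
def HenkinCond (X : ℕ → Prop) (s x y z w : ℕ) : Prop :=
  (X (kE x x) ∧ (X (kE x y) → X (kE y x)) ∧ (X (kE x y) → X (kE y z) → X (kE x z)) ∧
    (X (kE x y) → X (kE z w) → X (kE (addD x z) (addD y w))) ∧
    (X (kE x y) → X (kE z w) → X (kE (mulD x z) (mulD y w)))) ∧
  (X (kE (clo x tZero y) zeroD) ∧ X (kE (clo x tOne y) oneD) ∧
    X (kE (clo x (tAdd y z) w) (addD (clo x y w) (clo x z w))) ∧
    X (kE (clo x (tMul y z) w) (mulD (clo x y w) (clo x z w))) ∧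
    X (kE (clo (x + 1) (tVar x) (Nat.pair y z)) z) ∧
    -- The variable `w` is not the last of `x + w + 1 + 1`, so the last entry `z` of the environment
    -- may be dropped.
    X (kE (clo (x + w + 1 + 1) (tVar w) (Nat.pair y z)) (clo (x + w + 1) (tVar w) y))) ∧
  (¬ X (kS x fBot y) ∧
    (X (kS x (fEq y z) w) → X (kE (clo x y w) (clo x z w))) ∧
    (X (kE (clo x y w) (clo x z w)) → X (kS x (fEq y z) w)) ∧
    (X (kS x (fImp y z) w) → X (kS x y w) → X (kS x z w)) ∧
    ((X (kS x y w) → X (kS x z w)) → X (kS x (fImp y z) w)) ∧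
    (X (kS x (fAll y) z) → X (kS (x + 1) y (Nat.pair z w))) ∧
    -- The single instance at `wit` stands for all instances and keeps the condition free of
    -- quantifiers; `ind` serves the same purpose in the induction clause.
    (X (kS (x + 1) y (Nat.pair z (wit x y z))) → X (kS x (fAll y) z))) ∧
  (¬ X (kE (addD x oneD) zeroD) ∧
    (X (kE (addD x oneD) (addD y oneD)) → X (kE x y)) ∧
    X (kE (addD x zeroD) x) ∧
    X (kE (addD x (addD y oneD)) (addD (addD x y) oneD)) ∧
    X (kE (mulD x zeroD) zeroD) ∧
    X (kE (mulD x (addD y oneD)) (addD (mulD x y) x)) ∧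
    (X (kS (x + 1) y (Nat.pair z zeroD)) →
      (X (kS (x + 1) y (Nat.pair z (ind x y z))) →
        X (kS (x + 1) y (Nat.pair z (addD (ind x y z) oneD)))) →
      X (kS (x + 1) y (Nat.pair z w)))) ∧
  ¬ X (kS 0 s 0)

/-! ### From a model to a set of codes -/

section OfModel

variable (M : Type) [arith.Structure M] [Nonempty M]

/-- The codes of the true statements about the model `M`. -/
def diagram (k : ℕ) : Prop :=
  (k.unpair.1 = 0 ∧ val M k.unpair.2.unpair.1 = val M k.unpair.2.unpair.2) ∨
    (k.unpair.1 = 1 ∧ (decF k.unpair.2.unpair.1 k.unpair.2.unpair.2.unpair.1).Realize default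
      (envVal M k.unpair.2.unpair.1 k.unpair.2.unpair.2.unpair.2))

lemma diagram_kE (d e : ℕ) : diagram M (kE d e) ↔ val M d = val M e := by
  simp [diagram, kE]

lemma diagram_kS (n c a : ℕ) :
    diagram M (kS n c a) ↔ (decF n c).Realize default (envVal M n a) := by
  have key : ∀ p : ℕ, p = Nat.pair n (Nat.pair c a) →
      ((decF p.unpair.1 p.unpair.2.unpair.1).Realize default
        (envVal M p.unpair.1 p.unpair.2.unpair.2) ↔
      (decF n c).Realize default (envVal M n a)) := by
    rintro p rfl
    generalize h : Nat.unpair (Nat.pair n (Nat.pair c a)) = q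
    rw [Nat.unpair_pair] at h
    subst h
    simp only [Nat.unpair_pair]
  rw [diagram]
  refine Iff.trans ?_ (key (kS n c a).unpair.2 (by simp [kS]))
  simp [kS]

lemma val_clo_tVar_last (n a d : ℕ) : val M (clo (n + 1) (tVar n) (Nat.pair a d)) = val M d := by
  rw [val_clo, show decT (n + 1) (tVar n) = _ from decT_tVar (n + 1) (Fin.last n),
    envVal_succ_pair]
  simp

lemma val_clo_tVar_castSucc (n i a d : ℕ) (hi : i < n) :
    val M (clo (n + 1) (tVar i) (Nat.pair a d)) = val M (clo n (tVar i) a) := by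
  rw [val_clo, val_clo, show decT n (tVar i) = _ from decT_tVar n ⟨i, hi⟩,
    show decT (n + 1) (tVar i) = _ from decT_tVar (n + 1) (Fin.castSucc ⟨i, hi⟩),
    envVal_succ_pair, Term.realize_var, Term.realize_var, Sum.elim_inr, Sum.elim_inr,
    Fin.snoc_castSucc]

variable {M} in
theorem PeanoLaws.henkinCond_diagram (hM : PeanoLaws M) {s : ℕ}
    (hs : ¬ (decF 0 s).Realize default (default : Fin 0 → M)) (x y z w : ℕ) :
    HenkinCond (diagram M) s x y z w := by
  refine ⟨⟨?_, ?_, ?_, ?_, ?_⟩, ⟨?_, ?_, ?_, ?_, ?_, ?_⟩, ⟨?_, ?_, ?_, ?_, ?_, ?_, ?_⟩,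
    ⟨?_, ?_, ?_, ?_, ?_, ?_, ?_⟩, ?_⟩
  all_goals simp only [diagram_kE, diagram_kS, val_addD, val_mulD, val_zeroD, val_oneD]
  · exact Eq.symm
  · exact Eq.trans
  · exact congrArg₂ _
  · exact congrArg₂ _
  · rw [val_clo, decT_tZero, term_realize_zero]
  · rw [val_clo, decT_tOne, term_realize_one]
  · rw [val_clo, val_clo, val_clo, decT_tAdd, term_realize_add]
  · rw [val_clo, val_clo, val_clo, decT_tMul, term_realize_mul]
  · exact val_clo_tVar_last M x y z
  · exact val_clo_tVar_castSucc M _ _ _ _ (by omega)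
  · rw [decF_fBot]
    exact id
  · rw [decF_fEq, BoundedFormula.realize_bdEqual, val_clo, val_clo]
    exact id
  · rw [decF_fEq, BoundedFormula.realize_bdEqual, val_clo, val_clo]
    exact id
  · rw [decF_fImp, BoundedFormula.realize_imp]
    exact id
  · rw [decF_fImp, BoundedFormula.realize_imp]
    exact id
  · rw [decF_fAll, BoundedFormula.realize_all, envVal_succ_pair]
    exact fun h => h _
  · rw [decF_fAll, BoundedFormula.realize_all, envVal_succ_pair, val_wit]
    intro h
    by_contra hc
    push Not at hc
    -- If a counterexample existed, the value of `wit` would be one.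
    exact Classical.epsilon_spec hc h
  · exact hM.succ_ne_zero _
  · exact hM.succ_inj _ _
  · exact hM.add_zero _
  · exact hM.add_succ _ _
  · exact hM.mul_zero _
  · exact hM.mul_succ _ _
  · simp only [envVal_succ_pair, val_addD, val_oneD, val_zeroD, val_ind]
    intro h0 h
    refine hM.induction x (decF (x + 1) y) _ h0 ?_ _
    by_contra hc
    push Not at hc
    have := Classical.epsilon_spec hc
    exact this.2 (h this.1)
  · rwa [show envVal M 0 0 = default from Subsingleton.elim _ _]

end OfModel

/-! ### From a set of codes to a model -/

section OfCond

variable {X : ℕ → Prop} {s : ℕ} (h : ∀ x y z w, HenkinCond X s x y z w)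

/-- The equality relation of the model described by `X`. -/
def henkinSetoid : Setoid ℕ where
  r d e := X (kE d e)
  iseqv :=
    { refl := fun x => (h x x x x).1.1
      symm := fun {x y} => (h x y x x).1.2.1
      trans := fun {x y z} => (h x y z x).1.2.2.1 }

/-- The model described by `X`. -/
def HenkinModel : Type := Quotient (henkinSetoid h)

/-- The element of the model described by `X` with the code `d`. -/
def HenkinModel.mk (d : ℕ) : HenkinModel h := Quotient.mk (henkinSetoid h) d

namespace HenkinModel

lemma mk_eq {d e : ℕ} : mk h d = mk h e ↔ X (kE d e) := Quotient.eq (r := henkinSetoid h)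

instance : Nonempty (HenkinModel h) := ⟨mk h 0⟩

lemma exists_mk (q : HenkinModel h) : ∃ d, mk h d = q := Quotient.exists_rep q

instance : arith.Structure (HenkinModel h) where
  funMap
    | ArithFunc.zero, _ => mk h zeroD
    | ArithFunc.one, _ => mk h oneD
    | ArithFunc.add, q => Quotient.map₂ (sa := henkinSetoid h) (sb := henkinSetoid h)
        (sc := henkinSetoid h) addD
        (fun x y hxy z w hzw => (h x y z w).1.2.2.2.1 hxy hzw) (q 0) (q 1)
    | ArithFunc.mul, q => Quotient.map₂ (sa := henkinSetoid h) (sb := henkinSetoid h)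
        (sc := henkinSetoid h) mulD
        (fun x y hxy z w hzw => (h x y z w).1.2.2.2.2 hxy hzw) (q 0) (q 1)
  RelMap r _ := nomatch r

lemma zeroOf_eq : zeroOf (HenkinModel h) = mk h zeroD := rfl

lemma oneOf_eq : oneOf (HenkinModel h) = mk h oneD := rfl

lemma addOf_mk (d e : ℕ) : addOf (mk h d) (mk h e) = mk h (addD d e) := rfl

lemma mulOf_mk (d e : ℕ) : mulOf (mk h d) (mk h e) = mk h (mulD d e) := rfl

lemma mk_comp_env_succ (n a d : ℕ) : (fun i => mk h (env (n + 1) (Nat.pair a d) i)) =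
    Fin.snoc (fun i => mk h (env n a i)) (mk h d) := by
  funext i
  rw [env_succ_pair]
  refine Fin.lastCases ?_ (fun i => ?_) i <;> simp

lemma exists_env (n : ℕ) (v : Fin n → HenkinModel h) : ∃ a, (fun i => mk h (env n a i)) = v := by
  choose f hf using fun i => exists_mk h (v i)
  obtain ⟨a, ha⟩ := Arith.exists_env f
  exact ⟨a, by simp [ha, hf]⟩

lemma mk_clo_tVar (n a : ℕ) (i : Fin n) : mk h (clo n (tVar i) a) = mk h (env n a i) := by
  induction n generalizing a with
  | zero => exact i.elim0
  | succ n ih =>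
    obtain ⟨b, d, rfl⟩ : ∃ b d, a = Nat.pair b d := ⟨_, _, (Nat.pair_unpair a).symm⟩
    rw [env_succ_pair]
    refine Fin.lastCases ?_ (fun i => ?_) i
    · rw [Fin.snoc_last, mk_eq]
      exact (h n b d 0).2.1.2.2.2.2.1
    · rw [Fin.snoc_castSucc, ← ih, mk_eq]
      -- The parameter `n - i - 1` makes the number of variables `x + w + 1` of the clause equal to
      -- `n`.
      have := (h (n - i - 1) b d i).2.1.2.2.2.2.2
      rwa [show n - i - 1 + i + 1 = n by omega] at this

lemma realize_term {n : ℕ} (t : arith.Term (Empty ⊕ Fin n)) (a : ℕ) :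
    t.realize (Sum.elim default fun i => mk h (env n a i)) = mk h (clo n (encT t) a) := by
  induction t with
  | var i =>
    rcases i with i | i
    · exact i.elim
    · exact (mk_clo_tVar h n a i).symm
  | func f ts ih =>
    cases f with
    | zero => exact ((mk_eq h).2 (h n a 0 0).2.1.1).symm
    | one => exact ((mk_eq h).2 (h n a 0 0).2.1.2.1).symm
    | add =>
      rw [func_add_eq, term_realize_add, ih, ih, addOf_mk]
      exact ((mk_eq h).2 (h n _ _ a).2.1.2.2.1).symm
    | mul =>
      rw [func_mul_eq, term_realize_mul, ih, ih, mulOf_mk]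
      exact ((mk_eq h).2 (h n _ _ a).2.1.2.2.2.1).symm

/-- The truth lemma. In the universal case, every element has a code, and the instance at `wit`
yields the converse. -/
lemma realize_formula {n : ℕ} (φ : arith.BoundedFormula Empty n) (a : ℕ) :
    φ.Realize default (fun i => mk h (env n a i)) ↔ X (kS n (encF φ) a) := by
  induction φ generalizing a with
  | falsum => exact (iff_false_intro (h _ a 0 0).2.2.1.1).symm
  | @equal n s t =>
    refine Iff.trans (?_ : _ ↔ mk h (clo n (encT s) a) = mk h (clo n (encT t) a)) ?_
    · rw [← realize_term, ← realize_term]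
      rfl
    · rw [mk_eq]
      exact ⟨(h n _ _ a).2.2.1.2.2.1, (h n _ _ a).2.2.1.2.1⟩
  | rel r => exact r.elim
  | imp φ ψ ihφ ihψ =>
    rw [BoundedFormula.realize_imp, ihφ, ihψ]
    exact ⟨(h _ _ _ a).2.2.1.2.2.2.2.1, (h _ _ _ a).2.2.1.2.2.2.1⟩
  | @all n φ ih =>
    rw [BoundedFormula.realize_all]
    constructor
    · intro hφ
      refine (h n _ a 0).2.2.1.2.2.2.2.2.2 ?_
      rw [← ih, mk_comp_env_succ]
      exact hφ _
    · intro hX q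
      obtain ⟨d, rfl⟩ := exists_mk h q
      rw [← mk_comp_env_succ, ih]
      exact (h n _ a d).2.2.1.2.2.2.2.2.1 hX

lemma peanoLaws : PeanoLaws (HenkinModel h) where
  succ_ne_zero q := by
    obtain ⟨x, rfl⟩ := exists_mk h q
    rw [oneOf_eq, addOf_mk, zeroOf_eq, Ne, mk_eq]
    exact (h x 0 0 0).2.2.2.1.1
  succ_inj q r := by
    obtain ⟨x, rfl⟩ := exists_mk h q
    obtain ⟨y, rfl⟩ := exists_mk h r
    rw [oneOf_eq, addOf_mk, addOf_mk, mk_eq, mk_eq]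
    exact (h x y 0 0).2.2.2.1.2.1
  add_zero q := by
    obtain ⟨x, rfl⟩ := exists_mk h q
    rw [zeroOf_eq, addOf_mk, mk_eq]
    exact (h x 0 0 0).2.2.2.1.2.2.1
  add_succ q r := by
    obtain ⟨x, rfl⟩ := exists_mk h q
    obtain ⟨y, rfl⟩ := exists_mk h r
    rw [oneOf_eq, addOf_mk, addOf_mk, addOf_mk, addOf_mk, mk_eq]
    exact (h x y 0 0).2.2.2.1.2.2.2.1
  mul_zero q := by
    obtain ⟨x, rfl⟩ := exists_mk h q
    rw [zeroOf_eq, mulOf_mk, mk_eq]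
    exact (h x 0 0 0).2.2.2.1.2.2.2.2.1
  mul_succ q r := by
    obtain ⟨x, rfl⟩ := exists_mk h q
    obtain ⟨y, rfl⟩ := exists_mk h r
    rw [oneOf_eq, addOf_mk, mulOf_mk, mulOf_mk, addOf_mk, mk_eq]
    exact (h x y 0 0).2.2.2.1.2.2.2.2.2.1
  induction n φ v := by
    obtain ⟨a, rfl⟩ := exists_env h n v
    intro h0 hs q
    obtain ⟨w, rfl⟩ := exists_mk h q
    -- The induction step is needed only at the element that would refute it.
    have hs' := hs (mk h (ind n (encF φ) a))
    rw [oneOf_eq, addOf_mk] at hs'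
    rw [zeroOf_eq] at h0
    simp only [← mk_comp_env_succ, realize_formula] at h0 hs' ⊢
    exact (h n (encF φ) a w).2.2.2.1.2.2.2.2.2.2 h0 hs'

end HenkinModel

end OfCond

/-- A sentence fails in some model of Peano arithmetic if and only if there is a set of natural
numbers that describes such a model. -/
theorem not_models_iff (α : arith.Sentence) :
    ¬ peano ⊨ᵇ α ↔ ∃ X : ℕ → Prop, ∀ x y z w, HenkinCond X (encF (n := 0) α) x y z w := by
  rw [Theory.models_sentence_iff]
  constructor
  · intro h
    push Not at h
    obtain ⟨M, hM⟩ := h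
    refine ⟨diagram M, (model_peano_iff.1 M.is_model).henkinCond_diagram ?_⟩
    rw [decF_encF]
    exact hM
  · rintro ⟨X, h⟩ hα
    have : HenkinModel h ⊨ peano := model_peano_iff.2 (HenkinModel.peanoLaws h)
    have hr := hα (Theory.ModelType.of peano (HenkinModel h))
    refine (h 0 0 0 0).2.2.2.2 ((HenkinModel.realize_formula h (n := 0) α 0).1 ?_)
    rw [show (fun i => HenkinModel.mk h (env 0 0 i)) = default from Subsingleton.elim _ _]
    exact hr

/-! ### Provability from the Peano axioms is arithmetical -/

/-- An ultrafilter limit commutes with Boolean connectives, and `HenkinCond` is a Boolean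
combination of membership statements. -/
lemma henkinCond_ultrafilter {ι : Type} (F : Ultrafilter ι) (X : ι → ℕ → Prop) (s x y z w : ℕ) :
    HenkinCond (fun k => ∀ᶠ i in F, X i k) s x y z w ↔
      ∀ᶠ i in F, HenkinCond (X i) s x y z w := by
  simp only [HenkinCond, Filter.eventually_and, Ultrafilter.eventually_imp,
    Filter.eventually_const]

/-- The finite set with the code `b`. -/
def finiteSet (b k : ℕ) : Prop := (Denumerable.ofNat (List ℕ) b).getD k 0 = 1

lemma exists_finiteSet (X : ℕ → Prop) (n : ℕ) : ∃ b, ∀ k < n, finiteSet b k ↔ X k := by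
  classical
  refine ⟨Encodable.encode ((List.range n).map fun k => if X k then 1 else 0), fun k hk => ?_⟩
  simp [finiteSet, List.getD_eq_getElem?_getD, hk]

/-- `HenkinCond` for a finite set, with all parameters coded by one number. -/
def FiniteHenkinCond (b s p : ℕ) : Prop :=
  HenkinCond (finiteSet b) s p.unpair.1 p.unpair.2.unpair.1 p.unpair.2.unpair.2.unpair.1
    p.unpair.2.unpair.2.unpair.2

open Filter in
/-- Compactness: it is enough to satisfy finitely many of the conditions at a time. -/
theorem exists_henkinCond_iff (s : ℕ) :
    (∃ X : ℕ → Prop, ∀ x y z w, HenkinCond X s x y z w) ↔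
      ∀ N, ∃ b, ∀ p < N, FiniteHenkinCond b s p := by
  constructor
  · rintro ⟨X, h⟩ N
    choose b hb using exists_finiteSet X
    -- `X` is the limit of its truncations, so any finitely many conditions pass to some truncation,
    -- with no bound to compute.
    have hX : X = fun k => ∀ᶠ n in (hyperfilter ℕ : Filter ℕ), finiteSet (b n) k := by
      funext k
      have hk : ∀ᶠ n in (hyperfilter ℕ : Filter ℕ), k < n :=
        Nat.hyperfilter_le_atTop (eventually_gt_atTop k)
      have : (∀ᶠ n in (hyperfilter ℕ : Filter ℕ), finiteSet (b n) k) ↔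
          ∀ᶠ n in (hyperfilter ℕ : Filter ℕ), X k :=
        eventually_congr (hk.mono fun n hn => hb n k hn)
      rw [this, eventually_const]
    have : ∀ᶠ n in (hyperfilter ℕ : Filter ℕ), ∀ p ∈ Finset.range N,
        FiniteHenkinCond (b n) s p := by
      rw [Filter.eventually_all_finset]
      intro p _
      refine (henkinCond_ultrafilter (hyperfilter ℕ) (fun n => finiteSet (b n)) s ..).1 ?_
      rw [← hX]
      exact h _ _ _ _
    obtain ⟨n, hn⟩ := this.exists
    exact ⟨b n, fun p hp => hn p (Finset.mem_range.2 hp)⟩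
  · intro h
    choose b hb using h
    -- Each condition holds for all sufficiently large `n`, hence in the limit along a nonprincipal
    -- ultrafilter.
    refine ⟨fun k => ∀ᶠ n in (hyperfilter ℕ : Filter ℕ), finiteSet (b n) k, fun x y z w => ?_⟩
    rw [henkinCond_ultrafilter]
    have hp : ∀ᶠ n in (hyperfilter ℕ : Filter ℕ),
        Nat.pair x (Nat.pair y (Nat.pair z w)) < n :=
      Nat.hyperfilter_le_atTop (eventually_gt_atTop _)
    exact hp.mono fun n hn => by simpa [FiniteHenkinCond] using hb n _ hn

/-! ### Arithmetisation of the closure conditions -/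

section Primrec

open Primrec

lemma primrec_pair {α : Type} [Primcodable α] {f g : α → ℕ} (hf : Primrec f) (hg : Primrec g) :
    Primrec fun a => Nat.pair (f a) (g a) := Primrec₂.natPair.comp hf hg

lemma primrecPred_imp {α : Type} [Primcodable α] {p q : α → Prop} (hp : PrimrecPred p)
    (hq : PrimrecPred q) : PrimrecPred fun a => p a → q a :=
  (hp.not.or hq).of_eq fun a => by tauto

lemma primrecPred_finiteSet {α : Type} [Primcodable α] {f g : α → ℕ} (hf : Primrec f)
    (hg : Primrec g) : PrimrecPred fun a => finiteSet (f a) (g a) :=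
  Primrec.eq.comp ((list_getD 0).comp ((Primrec.ofNat (List ℕ)).comp hf) hg)
    (Primrec.const 1)

lemma primrecPred_henkinCond {α : Type} [Primcodable α] {b s x y z w : α → ℕ} (hb : Primrec b)
    (hs : Primrec s) (hx : Primrec x) (hy : Primrec y) (hz : Primrec z) (hw : Primrec w) :
    PrimrecPred fun a => HenkinCond (finiteSet (b a)) (s a) (x a) (y a) (z a) (w a) := by
  simp only [HenkinCond, kE, kS, clo, wit, ind, zeroD, oneD, addD, mulD, tVar, tZero, tOne, tAdd,
    tMul, fBot, fEq, fImp, fAll]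
  have add {f g : α → ℕ} (hf : Primrec f) (hg : Primrec g) : Primrec fun a => f a + g a :=
    nat_add.comp hf hg
  repeat' with_reducible first
    | refine PrimrecPred.and ?_ ?_
    | refine PrimrecPred.not ?_
    | refine primrecPred_imp ?_ ?_
    | refine primrecPred_finiteSet hb ?_
    | refine primrec_pair ?_ ?_
    | assumption
    | refine add ?_ ?_
    | exact Primrec.const _

/-- The code of the numeral `n`. -/
def numeralCode (n : ℕ) : ℕ := Nat.rec tZero (fun _ t => tAdd t tOne) n

/-- The code of `∀ x, x = n → φ(x)`, where `c` is the code of `φ`. -/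
def atNumeralCode (c n : ℕ) : ℕ := fAll (fImp (fEq (tVar 0) (numeralCode n)) c)

lemma encT_numeral {k : ℕ} (n : ℕ) :
    encT (numeral n : arith.Term (Empty ⊕ Fin k)) = numeralCode n := by
  induction n with
  | zero => rfl
  | succ n ih => exact congrArg (fun t => tAdd t tOne) ih

lemma encF_atNumeral (φ : arith.BoundedFormula Empty 1) (n : ℕ) :
    encF (n := 0) (atNumeral φ n) = atNumeralCode (encF φ) n :=
  congrArg (fun t => fAll (fImp (fEq (tVar 0) t) (encF φ))) (encT_numeral n)

lemma primrec_numeralCode : Primrec numeralCode :=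
  nat_rec₁ _ (primrec_pair (Primrec.const 3) (primrec_pair snd (Primrec.const tOne))).to₂

lemma primrec_atNumeralCode_diag : Primrec fun n => atNumeralCode n n :=
  primrec_pair (Primrec.const 3) <| primrec_pair (Primrec.const 2) <| primrec_pair
    (primrec_pair (Primrec.const 1) (primrec_pair (Primrec.const _) primrec_numeralCode)) Primrec.id

/-- The codes `n` of the formulas `φ` for which `φ(n)` does not follow from the Peano axioms form
an arithmetical set. -/
theorem arithmetical_exists_henkinCond : Arithmetical fun v : Fin 1 → ℕ =>
    ∃ X : ℕ → Prop, ∀ x y z w, HenkinCond X (atNumeralCode (v 0) (v 0)) x y z w := by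
  refine Arithmetical.of_iff (P := fun v : Fin 1 → ℕ => ∀ N, ∃ b, ∀ p, p < N →
    FiniteHenkinCond b (atNumeralCode (v 0) (v 0)) p) ?_ fun v => exists_henkinCond_iff _
  refine Arithmetical.all <| Arithmetical.ex <| Arithmetical.all <|
    (Arithmetical.lt (.var _) (.var _)).imp <|
    Arithmetical.of_primrecPred₃ (p := fun b n p => FiniteHenkinCond b (atNumeralCode n n) p)
      ?_ (.var _) (.var _) (.var _)
  have hp : Primrec fun x : ℕ × ℕ × ℕ => x.2.2.unpair := unpair.comp (snd.comp snd)
  have hp' := unpair.comp (snd.comp hp)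
  have hp'' := unpair.comp (snd.comp hp')
  exact primrecPred_henkinCond fst (primrec_atNumeralCode_diag.comp (fst.comp snd)) (fst.comp hp)
    (fst.comp hp') (fst.comp hp'') (snd.comp hp'')

end Primrec

/-! ### Soundness and incompleteness -/

theorem consequences_peano_subset :
    {α : arith.Sentence | peano ⊨ᵇ α} ⊆ arith.completeTheory ℕ := fun _ hα =>
  Theory.models_sentence_iff.1 hα (Theory.ModelType.of peano ℕ)

/-- Peano arithmetic is incomplete. -/
theorem consequences_peano_ssubset :
    {α : arith.Sentence | peano ⊨ᵇ α} ⊂ arith.completeTheory ℕ := by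
  refine consequences_peano_subset.ssubset_of_not_subset fun hsub => ?_
  obtain ⟨φ, hφ⟩ := arithmetical_exists_henkinCond.exists_boundedFormula
  -- Applied to its own code, `φ` says that `atNumeral φ (encF φ)` does not follow from PA.
  have h := hφ fun _ => encF φ
  rw [← encF_atNumeral, ← not_models_iff] at h
  have hN : ℕ ⊨ atNumeral φ (encF φ) ↔ φ.Realize default fun _ => encF φ := by
    convert realize_atNumeral φ (encF φ)
    rfl
  by_cases hα : peano ⊨ᵇ atNumeral φ (encF φ)
  · exact h.1 (hN.1 (consequences_peano_subset hα)) hα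
  · exact hα (hsub (hN.2 (h.2 hα)))

end Arith

theorem mainTheorem9 :
    -- the theory of `⟨ℕ; +, ·; 0, 1⟩` is undecidable
    ¬ Arith.DecidableTheory (Arith.arith.completeTheory ℕ) ∧
    -- the consequences of the Peano axioms are a proper part of the theory of `⟨ℕ; +, ·; 0, 1⟩`
    {α : Arith.arith.Sentence | Arith.peano ⊨ᵇ α} ⊂ Arith.arith.completeTheory ℕ ∧
    -- the theory of `⟨ℤ; +, ·; 0, 1⟩` is undecidable
    ¬ Arith.DecidableTheory (Arith.arith.completeTheory ℤ) :=
  ⟨Arith.not_decidableTheory_nat, Arith.consequences_peano_ssubset, Arith.not_decidableTheory_int⟩
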